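/- Let $M\ge 1$ be an integer. An expansion of a real number $x$ in base $q>1$ is a sequence $(c_i)_{i\ge1}$ of digits $c_i\in\{0,1,\dots,M\}$ with $x=(c_1c_2\cdots)_q:=\sum_{i\ge 1}c_iq^{-i}$; the lexicographically largest expansion of $x$ is called its greedy expansion. Let $\mathcal U$ be the set of all $q\in(1,M+1]$ such that $1$ has exactly one expansion in base $q$, let $\overline{\mathcal U}$ be its topological closure in $\mathbb R$, and let $q\in\overline{\mathcal U}\setminus\mathcal U$. Then the greedy expansion of $1$ in base $q$ exists and is finite, i.e. of the form $\beta_1\cdots\beta_N0^\infty$ with $N\ge1$ and $\beta_N\neq0$. For $i\ge 1$ put $$a_i:=(\beta_i\beta_{i+1}\cdots)_q=(\beta_i\cdots\beta_N0^\infty)_q,\qquad b_i:=\frac{M}{q-1}-a_i$$ (so $a_i=0$ for $i>N$), and let $S_q:=\bigcup_{j=1}^M\left[\frac jq,\ \frac{j-1}q+\frac M{q^2-q}\right]$. Let $\mathcal G(q)$ be the labeled directed graph whose vertices are the connected components of $$\Big(0,\frac M{q-1}\Big)\setminus\big(S_q\cup\{a_1,\dots,a_N,b_1,\dots,b_N\}\big),$$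 and whose edges are the triplets $(I,k,J)$ where $I,J$ are vertices, $k\in\{0,\dots,M\}$ and $J\subset T_k(I)$ with $T_k(x):=qx-k$. Let $\tilde{\mathcal G}(q)$ be the subgraph of $\mathcal G(q)$ obtained by keeping only the vertices that are subintervals of $(b_1,a_1)$, together with all edges between them. If $$b_2<\min\{a_i : 1<i<N\}$$ (a condition regarded as satisfied when $N\le 2$), then $\tilde{\mathcal G}(q)$ is strongly connected: for every ordered pair $(I,J)$ of vertices of $\tilde{\mathcal G}(q)$, including $I=J$, there is a path with at least one edge in $\tilde{\mathcal G}(q)$ from $I$ to $J$. -/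

import Mathlib

namespace Univoque

noncomputable section

/-- The value `(c)_q = c₁/q + c₂/q² + ⋯` of a digit sequence.  Sequences are indexed from `0`,
so `c n` is the `(n+1)`-st digit. -/
def seqValue (q : ℝ) (c : ℕ → ℕ) : ℝ := ∑' n, (c n : ℝ) / q ^ (n + 1)

/-- `c` is an expansion of `x` in base `q` over the alphabet `{0, …, M}`. -/
def IsExpansion (M : ℕ) (q x : ℝ) (c : ℕ → ℕ) : Prop :=
  (∀ n, c n ≤ M) ∧ HasSum (fun n => (c n : ℝ) / q ^ (n + 1)) x

/-- `c` is the greedy, i.e. the lexicographically largest, expansion of `x` in base `q`. -/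
def IsGreedyExpansion (M : ℕ) (q x : ℝ) (c : ℕ → ℕ) : Prop :=
  IsExpansion M q x c ∧ ∀ d, IsExpansion M q x d → toLex d ≤ toLex c

/-- The set `𝒰` of the bases in which `1` has a unique expansion. -/
def univoqueBases (M : ℕ) : Set ℝ :=
  {q | q ∈ Set.Ioc (1 : ℝ) (M + 1) ∧ ∃! c : ℕ → ℕ, IsExpansion M q 1 c}

/-- `N` (counted from `1`) is the position of the last nonzero digit of `c`:
`c = c₁ ⋯ c_N 0^∞` with `c_N ≠ 0`. -/
def IsLastNonzero (c : ℕ → ℕ) (N : ℕ) : Prop :=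
  1 ≤ N ∧ c (N - 1) ≠ 0 ∧ ∀ n, N ≤ n → c n = 0

/-- The point `a_i = (β_i β_{i+1} ⋯)_q`, for `i ≥ 1`; here `β_i` is `β (i - 1)`. -/
def aPt (q : ℝ) (β : ℕ → ℕ) (i : ℕ) : ℝ := seqValue q (fun n => β (n + (i - 1)))

/-- The reflected point `b_i = M/(q-1) - a_i`. -/
def bPt (M : ℕ) (q : ℝ) (β : ℕ → ℕ) (i : ℕ) : ℝ := (M : ℝ) / (q - 1) - aPt q β i

/-- The switch region: the union of the intervals `[θ_j, η_j]` for `j = 1, …, M`, where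
`θ_j = j/q` and `η_j = (j-1)/q + M/(q²-q)`. -/
def switchRegion (M : ℕ) (q : ℝ) : Set ℝ :=
  ⋃ j ∈ Set.Icc 1 M, Set.Icc ((j : ℝ) / q) (((j : ℝ) - 1) / q + (M : ℝ) / (q ^ 2 - q))

/-- A directed graph with labeled edges; `(I, k, J)` is an edge from `I` to `J` with label `k`. -/
structure LabeledGraph (V L : Type*) where
  verts : Set V
  edges : Set (V × L × V)
  source_mem : ∀ e ∈ edges, e.1 ∈ verts
  target_mem : ∀ e ∈ edges, e.2.2 ∈ verts

namespace LabeledGraph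

variable {V L : Type*}

/-- There is an edge from `I` to `J`. -/
def Step (G : LabeledGraph V L) (I J : V) : Prop := ∃ k, (I, k, J) ∈ G.edges

/-- From every vertex to every vertex (also from a vertex to itself) there is a path with at
least one edge. -/
def StronglyConnected (G : LabeledGraph V L) : Prop :=
  ∀ I ∈ G.verts, ∀ J ∈ G.verts, Relation.TransGen G.Step I J

/-- The subgraph obtained by keeping only the vertices in `S`, and all the edges between them. -/
def induce (G : LabeledGraph V L) (S : Set V) : LabeledGraph V L where
  verts := {I | I ∈ G.verts ∧ I ∈ S}
  edges := {e | e ∈ G.edges ∧ e.1 ∈ S ∧ e.2.2 ∈ S}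
  source_mem e he := ⟨G.source_mem e he.1, he.2.1⟩
  target_mem e he := ⟨G.target_mem e he.1, he.2.2⟩

end LabeledGraph

/-- `(0, M/(q-1))` without the switch region and the points `a_1, …, a_N, b_1, …, b_N`. -/
def graphDomain (M : ℕ) (q : ℝ) (β : ℕ → ℕ) (N : ℕ) : Set ℝ :=
  Set.Ioo 0 ((M : ℝ) / (q - 1)) \
    (switchRegion M q ∪ {x | ∃ i ∈ Set.Icc 1 N, x = aPt q β i ∨ x = bPt M q β i})

/-- The vertices: the connected components of `graphDomain`. -/
def graphVertices (M : ℕ) (q : ℝ) (β : ℕ → ℕ) (N : ℕ) : Set (Set ℝ) :=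
  {I | ∃ x ∈ graphDomain M q β N, I = connectedComponentIn (graphDomain M q β N) x}

/-- The graph `𝒢(q)`: there is an edge from `I` to `J` labeled by a digit `k` exactly when
`J ⊆ T_k(I)`, where `T_k x = q x - k`. -/
def univoqueGraph (M : ℕ) (q : ℝ) (β : ℕ → ℕ) (N : ℕ) : LabeledGraph (Set ℝ) ℕ where
  verts := graphVertices M q β N
  edges := {e | e.1 ∈ graphVertices M q β N ∧ e.2.2 ∈ graphVertices M q β N ∧
    e.2.1 ≤ M ∧ e.2.2 ⊆ (fun x : ℝ => q * x - (e.2.1 : ℝ)) '' e.1}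
  source_mem _ he := he.1
  target_mem _ he := he.2.1

/-- The subgraph of `𝒢(q)` spanned by the vertices that are subintervals of `(b_1, a_1)`. -/
def reducedGraph (M : ℕ) (q : ℝ) (β : ℕ → ℕ) (N : ℕ) : LabeledGraph (Set ℝ) ℕ :=
  (univoqueGraph M q β N).induce {I | I ⊆ Set.Ioo (bPt M q β 1) (aPt q β 1)}

end

end Univoque

/-! The base `q` is studied through the orbit of `1` under the greedy map `x ↦ q x - ⌊q x⌋`, whose
points are the `a_i`. Everything rests on comparing this orbit with `b₁ = M/(q-1) - 1`.

*Arithmetic of the base.* For `1 < q < M + 1`, the base is univoque exactly when the orbit stays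
above `b₁` after the start (`lt_greedyOrbit_of_mem`, `mem_univoqueBases`): a digit can be changed
only at a point of the switch region, and `x ↦ q x - l` carries the `l`-th switch interval onto
`[0, b₁]`. A limit from the right of univoque bases is univoque again
(`mem_univoqueBases_of_frequently_gt`). At a limit from the left, the orbit can fail to stay above
`b₁` only by hitting `0` first (`exists_greedyOrbit_eq_zero`), because otherwise the failure would
persist at nearby smaller bases. So for `q` in the closure but not univoque, the greedy expansion
is finite, and `b₁ < a_i < 1` for `1 < i ≤ N`. In particular `a_i` lies outside the switch region
for `i < N`, while `a_N` is the left end of a switch interval; the `b_i` are the mirror images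
under `x ↦ M/(q-1) - x`.

*Edges.* The preimage of a vertex in `(b₁, 1)` under `x ↦ q x - j` lies in the domain
(`FiniteOrbit.mem_graphDomain_of_mul_sub`). Hence there is an edge from `I` to `J` as soon as the
image of `I` meets `J` (`FiniteOrbit.step_iff`), and paths can be followed through right
neighbourhoods of single points.

*Every vertex leads to the leftmost vertex* `(b₁, ·)` (`FiniteOrbit.reach_leftmost`). The left
endpoint of a vertex is some `a_i`, some `b_i`, or the right end of a switch interval. A right end
is mapped to `b₁`, and `b_i` moves along `b_{i+1}, …, b_N`, which is a right end. From `a_i` one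
arrives at `a_N`, and the image then contains the right end of the switch interval starting there;
this fails only for the image of `(a_{N-1}, b_{N-1})`, and a parity argument excludes that case
(`FiniteOrbit.mem_comp_of_penultimate`).

*The leftmost vertex leads to every vertex* (`FiniteOrbit.reached_of_mem`). Right neighbourhoods of
all `b_i` are reached. Let `s` be the left end of the leftmost unreached vertex. If `s = a_i`, the
hypothesis puts `s` to the right of `b₂`, and either `(b₂, 1)` is reached as an image of `(b₁, s)`,
or `a_{i+1}` is to the right of `a_i` and the image of `(b₁, s)` covers a right neighbourhood of
`s`. If `s` is the right end of a switch interval, then `(b₁, s)` contains a whole gap, whose image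
is `(b₁, 1)`, or else, by reflection, all unreached points lie in `[a₂, b₂]`, which is empty by
hypothesis for `N > 2` and is incompatible with `b₁ < a₂` for `N = 2`. -/

namespace Univoque

/-! ### Expansions and their tails -/

theorem IsExpansion.tail {M : ℕ} {q x : ℝ} (hq : 1 < q) {c : ℕ → ℕ} (h : IsExpansion M q x c) :
    IsExpansion M q (q * x - c 0) (fun n => c (n + 1)) := by
  refine ⟨fun n => h.1 _, ?_⟩
  have hq0 : q ≠ 0 := by positivity
  have h1 := ((hasSum_nat_add_iff' 1).2 h.2).mul_left q
  have e : q * (x - ∑ i ∈ Finset.range 1, (c i : ℝ) / q ^ (i + 1)) = q * x - c 0 := by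
    simp [mul_sub, mul_div_cancel₀ _ hq0]
  rw [e] at h1
  have e2 : (fun i => q * ((c (i + 1) : ℝ) / q ^ (i + 1 + 1))) =
      fun n => (c (n + 1) : ℝ) / q ^ (n + 1) := by
    funext n
    rw [pow_succ q (n + 1)]
    field_simp
  rwa [e2] at h1

theorem IsExpansion.cons {M : ℕ} {q x : ℝ} (hq : 1 < q) {d : ℕ} (hd : d ≤ M) {c : ℕ → ℕ}
    (h : IsExpansion M q (q * x - d) c) :
    IsExpansion M q x (fun n => Nat.casesOn n d c) := by
  refine ⟨fun n => by cases n <;> simp [hd, h.1], ?_⟩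
  have hq0 : q ≠ 0 := by positivity
  rw [← hasSum_nat_add_iff' 1]
  have h1 := h.2.mul_left q⁻¹
  have e1 : (fun i => q⁻¹ * ((c i : ℝ) / q ^ (i + 1))) =
      fun n => (c n : ℝ) / q ^ (n + 1 + 1) := by
    funext n
    rw [pow_succ q (n + 1)]
    field_simp
  have e2 : q⁻¹ * (q * x - d) =
      x - ∑ i ∈ Finset.range 1, ((Nat.casesOn i d c : ℕ) : ℝ) / q ^ (i + 1) := by
    simp
    field_simp
  rw [e1, e2] at h1
  exact h1

theorem IsExpansion.nonneg {M : ℕ} {q x : ℝ} (hq : 1 < q) {c : ℕ → ℕ}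
    (h : IsExpansion M q x c) : 0 ≤ x :=
  h.2.nonneg fun n => by positivity

theorem hasSum_const_digit {q : ℝ} (hq : 1 < q) (m : ℝ) :
    HasSum (fun n : ℕ => m / q ^ (n + 1)) (m / (q - 1)) := by
  have hq0 : q ≠ 0 := by positivity
  have hq1 : q - 1 ≠ 0 := by linarith
  have h := (hasSum_geometric_of_lt_one (by positivity) (inv_lt_one_of_one_lt₀ hq)).mul_left (m / q)
  have e1 : (fun n : ℕ => m / q * q⁻¹ ^ n) = fun n => m / q ^ (n + 1) := by
    funext n
    rw [inv_pow, pow_succ]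
    field_simp
  have e2 : m / q * (1 - q⁻¹)⁻¹ = m / (q - 1) := by
    have : 1 - q⁻¹ = (q - 1) / q := by field_simp
    rw [this]
    field_simp
  rwa [e1, e2] at h

theorem IsExpansion.le {M : ℕ} {q x : ℝ} (hq : 1 < q) {c : ℕ → ℕ}
    (h : IsExpansion M q x c) : x ≤ M / (q - 1) := by
  refine hasSum_le (fun n => ?_) h.2 (hasSum_const_digit hq M)
  have : (c n : ℝ) ≤ M := by exact_mod_cast h.1 n
  gcongr

/-- A bounded orbit of the maps `x ↦ q x - k` yields an expansion of its starting point. -/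
theorem isExpansion_of_orbit {M : ℕ} {q : ℝ} (hq : 1 < q) {c : ℕ → ℕ} (hc : ∀ n, c n ≤ M)
    {t : ℕ → ℝ} (ht : ∀ n, t (n + 1) = q * t n - c n) {B : ℝ} (h0 : ∀ n, 0 ≤ t n)
    (hB : ∀ n, t n ≤ B) : IsExpansion M q (t 0) c := by
  refine ⟨hc, ?_⟩
  have hq0 : 0 < q := by positivity
  have hpart : ∀ k, ∑ n ∈ Finset.range k, (c n : ℝ) / q ^ (n + 1) = t 0 - t k / q ^ k := by
    intro k
    induction k with
    | zero => simp
    | succ k ih =>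
      rw [Finset.sum_range_succ, ih, ht]
      field_simp
      ring
  have hlim : Filter.Tendsto (fun k => t k / q ^ k) Filter.atTop (nhds 0) := by
    have hg : Filter.Tendsto (fun k : ℕ => B / q ^ k) Filter.atTop (nhds 0) :=
      Filter.Tendsto.const_div_atTop (tendsto_pow_atTop_atTop_of_one_lt hq) B
    refine squeeze_zero (fun k => div_nonneg (h0 k) (by positivity)) (fun k => ?_) hg
    gcongr
    exact hB k
  rw [hasSum_iff_tendsto_nat_of_nonneg fun n => by positivity]
  simp_rw [hpart]
  simpa using hlim.const_sub (t 0)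

theorem exists_isExpansion {M : ℕ} {q : ℝ} (hq : 1 < q) (hqM : q ≤ M + 1) {x : ℝ} (h0 : 0 ≤ x)
    (hx : x ≤ M / (q - 1)) : ∃ c, IsExpansion M q x c := by
  have hq1 : 0 < q - 1 := by linarith
  set L : ℝ := M / (q - 1) with hL
  have hLq : L * (q - 1) = M := by rw [hL]; field_simp
  have hL1 : 1 ≤ L := by rw [hL, le_div_iff₀ hq1]; linarith
  -- the greedy choice: the largest admissible digit, capped at `M`
  let d : ℝ → ℕ := fun y => min M ⌊q * y⌋₊
  let t : ℕ → ℝ := fun n => Nat.rec x (fun _ y => q * y - d y) n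
  have ht : ∀ n, t (n + 1) = q * t n - d (t n) := fun n => rfl
  have hb : ∀ n, 0 ≤ t n ∧ t n ≤ L := by
    intro n
    induction n with
    | zero => exact ⟨h0, hx⟩
    | succ n ih =>
      rw [ht]
      have hnn : 0 ≤ q * t n := mul_nonneg (by linarith) ih.1
      have hfl := Nat.floor_le hnn
      have hlt := Nat.lt_floor_add_one (q * t n)
      rcases le_total M ⌊q * t n⌋₊ with h | h
      · have e : d (t n) = M := min_eq_left h
        have h' : (M : ℝ) ≤ ⌊q * t n⌋₊ := by exact_mod_cast h
        rw [e]
        constructor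
        · linarith
        · nlinarith [ih.2]
      · have e : d (t n) = ⌊q * t n⌋₊ := min_eq_right h
        rw [e]
        constructor <;> linarith
  exact ⟨_, isExpansion_of_orbit hq (c := fun n => d (t n)) (fun n => min_le_left _ _) ht
    (fun n => (hb n).1) (fun n => (hb n).2)⟩

/-- An orbit that never meets the switch region gives a unique expansion. -/
theorem unique_of_orbit {M : ℕ} {q : ℝ} (hq : 1 < q) {c : ℕ → ℕ} {t : ℕ → ℝ}
    (ht : ∀ n, t (n + 1) = q * t n - c n)
    (hlow : ∀ n, (M : ℝ) / (q - 1) - 1 < t (n + 1)) (hhigh : ∀ n, c n = M ∨ t (n + 1) < 1)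
    {d : ℕ → ℕ} (hd : IsExpansion M q (t 0) d) : d = c := by
  have key : ∀ n, IsExpansion M q (t n) (fun k => d (k + n)) → d n = c n := by
    intro n h
    have h1 := h.tail hq
    have hnn := h1.nonneg hq
    have hle := h1.le hq
    have hM := h.1 0
    simp only [zero_add] at hnn hle hM
    have e := ht n
    have hl := hlow n
    apply le_antisymm
    · rcases hhigh n with h2 | h2
      · rw [h2]; exact hM
      · have : (d n : ℝ) < c n + 1 := by linarith
        have : d n < c n + 1 := by exact_mod_cast this
        omega
    · have : (c n : ℝ) < d n + 1 := by linarith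
      have : c n < d n + 1 := by exact_mod_cast this
      omega
  have hall : ∀ n, IsExpansion M q (t n) (fun k => d (k + n)) := by
    intro n
    induction n with
    | zero => exact hd
    | succ n ih =>
      have h1 := ih.tail hq
      have e := key n ih
      simp only [zero_add, e, ← ht] at h1
      convert h1 using 2
      congr 1
      ring
  exact funext fun n => key n (hall n)

/-! ### The greedy orbit of `1` -/

/-- The orbit of `1` under the greedy map `x ↦ q x - ⌊q x⌋`. -/
noncomputable def greedyOrbit (q : ℝ) : ℕ → ℝ
  | 0 => 1
  | n + 1 => Int.fract (q * greedyOrbit q n)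

/-- The digits of the greedy expansion of `1` for `q < M + 1`. In this range no cap at `M`
is needed, since the orbit stays in `[0, 1]`. -/
noncomputable def greedyDigit (q : ℝ) (n : ℕ) : ℕ := ⌊q * greedyOrbit q n⌋₊

theorem greedyOrbit_nonneg (q : ℝ) (n : ℕ) : 0 ≤ greedyOrbit q n := by
  cases n with
  | zero => exact zero_le_one
  | succ n => exact Int.fract_nonneg _

theorem greedyOrbit_succ_lt (q : ℝ) (n : ℕ) : greedyOrbit q (n + 1) < 1 := Int.fract_lt_one _

theorem greedyOrbit_le_one (q : ℝ) (n : ℕ) : greedyOrbit q n ≤ 1 := by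
  cases n with
  | zero => exact le_rfl
  | succ n => exact (Int.fract_lt_one _).le

theorem greedyOrbit_succ {q : ℝ} (hq : 1 < q) (n : ℕ) :
    greedyOrbit q (n + 1) = q * greedyOrbit q n - greedyDigit q n := by
  have h : 0 ≤ q * greedyOrbit q n := mul_nonneg (by linarith) (greedyOrbit_nonneg q n)
  rw [greedyDigit, natCast_floor_eq_intCast_floor h]
  rfl

theorem greedyDigit_le {M : ℕ} {q : ℝ} (hq : 1 < q) (hqM : q < M + 1) (n : ℕ) :
    greedyDigit q n ≤ M := by
  have h1 := greedyOrbit_succ hq n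
  have h2 := greedyOrbit_nonneg q (n + 1)
  have h3 := greedyOrbit_le_one q n
  have : (greedyDigit q n : ℝ) < M + 1 := by nlinarith
  have : greedyDigit q n < M + 1 := by exact_mod_cast this
  omega

theorem isExpansion_greedyDigit {M : ℕ} {q : ℝ} (hq : 1 < q) (hqM : q < M + 1) :
    IsExpansion M q 1 (greedyDigit q) :=
  isExpansion_of_orbit hq (greedyDigit_le hq hqM) (greedyOrbit_succ hq) (greedyOrbit_nonneg q)
    (greedyOrbit_le_one q)

theorem isGreedyExpansion_greedyDigit {M : ℕ} {q : ℝ} (hq : 1 < q) (hqM : q < M + 1) :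
    IsGreedyExpansion M q 1 (greedyDigit q) := by
  refine ⟨isExpansion_greedyDigit hq hqM, fun d hd => ?_⟩
  by_contra hlt
  obtain ⟨n, heq, hn⟩ := not_le.1 hlt
  have hall : ∀ k, k ≤ n → IsExpansion M q (greedyOrbit q k) (fun i => d (i + k)) := by
    intro k
    induction k with
    | zero => exact fun _ => hd
    | succ k ih =>
      intro hk
      have h1 := (ih (by omega)).tail hq
      have e : d k = greedyDigit q k := (heq k (by omega)).symm
      simp only [zero_add, e, ← greedyOrbit_succ hq] at h1
      convert h1 using 2
      congr 1
      ring
  have h1 := ((hall n le_rfl).tail hq).nonneg hq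
  simp only [zero_add] at h1
  have h2 := greedyOrbit_succ_lt q n
  rw [greedyOrbit_succ hq] at h2
  have h3 : (d n : ℝ) < greedyDigit q n + 1 := by linarith
  have h4 : d n < greedyDigit q n + 1 := by exact_mod_cast h3
  have h5 : greedyDigit q n < d n := hn
  omega

theorem IsGreedyExpansion.eq_greedyDigit {M : ℕ} {q : ℝ} (hq : 1 < q) (hqM : q < M + 1)
    {β : ℕ → ℕ} (h : IsGreedyExpansion M q 1 β) : β = greedyDigit q :=
  toLex.injective (le_antisymm ((isGreedyExpansion_greedyDigit hq hqM).2 β h.1)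
    (h.2 _ (isExpansion_greedyDigit hq hqM)))

/-! ### Univoque bases in terms of the greedy orbit -/

/-- Every point of the orbit of `1` after the start lies above `b₁ = M/(q-1) - 1` when `q` is
univoque: otherwise the last nonzero digit before that point can be lowered by one. -/
theorem lt_greedyOrbit_of_mem {M : ℕ} {q : ℝ} (hqM : q < M + 1)
    (hU : q ∈ univoqueBases M) {k : ℕ} (hk : 1 ≤ k) : (M : ℝ) / (q - 1) - 1 < greedyOrbit q k := by
  obtain ⟨⟨hq, -⟩, hex⟩ := hU
  have huniq : ∀ d, IsExpansion M q 1 d → d = greedyDigit q := fun d hd =>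
    hex.unique hd (isExpansion_greedyDigit hq hqM)
  have htail : ∀ n d, IsExpansion M q (greedyOrbit q n) d → d 0 = greedyDigit q n ∧
      ∀ i, d i = greedyDigit q (i + n) := by
    intro n
    induction n with
    | zero =>
      intro d hd
      rw [huniq d hd]
      exact ⟨rfl, fun i => rfl⟩
    | succ n ih =>
      intro d hd
      rw [greedyOrbit_succ hq] at hd
      have h1 := (ih _ (hd.cons hq (greedyDigit_le hq hqM n))).2
      have h2 : ∀ i, d i = greedyDigit q (i + (n + 1)) := fun i => by
        have := h1 (i + 1)
        simp only at this
        rw [this]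
        congr 1
        ring
      exact ⟨by simpa using h2 0, h2⟩
  have hq1 : 0 < q - 1 := by linarith
  have hc : 0 < (M : ℝ) / (q - 1) - 1 := by
    rw [sub_pos, one_lt_div hq1]; linarith
  -- a positive digit followed by a point `≤ b₁` could be lowered by one
  have hlower : ∀ n, 1 ≤ greedyDigit q n → (M : ℝ) / (q - 1) - 1 < greedyOrbit q (n + 1) := by
    intro n hn
    by_contra hle
    obtain ⟨e, he⟩ := exists_isExpansion hq hqM.le (x := greedyOrbit q (n + 1) + 1)
      (by linarith [greedyOrbit_nonneg q (n + 1)]) (by linarith)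
    have h1 : greedyOrbit q (n + 1) + 1 = q * greedyOrbit q n - ((greedyDigit q n - 1 : ℕ) : ℝ) := by
      rw [greedyOrbit_succ hq, Nat.cast_sub hn]
      push_cast
      ring
    rw [h1] at he
    have h2 := (htail n _ (he.cons hq ((Nat.sub_le _ _).trans (greedyDigit_le hq hqM n)))).1
    change greedyDigit q n - 1 = greedyDigit q n at h2
    omega
  induction k, hk using Nat.le_induction with
  | base =>
    apply hlower
    have h1 := greedyOrbit_succ_lt q 0
    rw [greedyOrbit_succ hq, greedyOrbit, mul_one] at h1
    have : (0 : ℝ) < greedyDigit q 0 := by linarith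
    exact_mod_cast this
  | succ k hk ih =>
    by_cases h0 : greedyDigit q k = 0
    · rw [greedyOrbit_succ hq, h0]
      push_cast
      nlinarith
    · exact hlower k (by omega)

theorem mem_univoqueBases {M : ℕ} {q : ℝ} (hq : 1 < q) (hqM : q < M + 1)
    (h : ∀ k, (M : ℝ) / (q - 1) - 1 < greedyOrbit q (k + 1)) : q ∈ univoqueBases M :=
  ⟨⟨hq, hqM.le⟩, _, isExpansion_greedyDigit hq hqM, fun _ hd =>
    unique_of_orbit hq (greedyOrbit_succ hq) h (fun n => Or.inr (greedyOrbit_succ_lt q n)) hd⟩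

theorem succ_mem_univoqueBases {M : ℕ} (hM : 1 ≤ M) : (M : ℝ) + 1 ∈ univoqueBases M := by
  have hM' : (1 : ℝ) ≤ M := by exact_mod_cast hM
  have hq : (1 : ℝ) < M + 1 := by linarith
  have ht : ∀ n : ℕ, (1 : ℝ) = (M + 1) * 1 - M := fun n => by ring
  refine ⟨⟨hq, le_rfl⟩, fun _ => M, ?_, fun d hd => ?_⟩
  · exact isExpansion_of_orbit hq (t := fun _ => 1) (fun _ => le_rfl) ht (B := 1)
      (fun _ => zero_le_one) (fun _ => le_rfl)
  · refine unique_of_orbit hq (t := fun _ => 1) (c := fun _ => M) ht (fun _ => ?_)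
      (fun _ => Or.inl rfl) hd
    have : (M : ℝ) / (M + 1 - 1) = 1 := by
      rw [add_sub_cancel_right]; field_simp
    rw [this]; norm_num

/-- Univoque bases are bounded away from `1`. -/
theorem le_sq_sub_of_mem {M : ℕ} (hM : 1 ≤ M) {q : ℝ} (hU : q ∈ univoqueBases M) :
    (M : ℝ) ≤ q ^ 2 - q := by
  have hM' : (1 : ℝ) ≤ M := by exact_mod_cast hM
  obtain ⟨hq, hqM⟩ := hU.1
  rcases hqM.lt_or_eq with hlt | rfl
  · by_contra hcon
    have hq1 : 0 < q - 1 := by linarith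
    have h1 := lt_greedyOrbit_of_mem hlt hU le_rfl
    have h2 : q ≤ (M : ℝ) / (q - 1) := by
      rw [le_div_iff₀ hq1]; nlinarith
    rw [greedyOrbit_succ hq, greedyOrbit, mul_one] at h1
    have h3 := greedyOrbit_succ_lt q 0
    rw [greedyOrbit_succ hq, greedyOrbit, mul_one] at h3
    have h4 : (0 : ℝ) < greedyDigit q 0 := by linarith
    have h5 : 1 ≤ greedyDigit q 0 := by exact_mod_cast h4
    have h6 : (1 : ℝ) ≤ greedyDigit q 0 := by exact_mod_cast h5
    linarith
  · nlinarith

/-! ### Bases in the closure -/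

/-- The orbit of `1` in base `q'`, driven by the greedy digits of `1` in base `q`. As a function
of `q'` it is a polynomial that agrees with `greedyOrbit` at `q' = q`. -/
noncomputable def frozenOrbit (q q' : ℝ) : ℕ → ℝ
  | 0 => 1
  | n + 1 => q' * frozenOrbit q q' n - greedyDigit q n

theorem frozenOrbit_self {q : ℝ} (hq : 1 < q) (n : ℕ) : frozenOrbit q q n = greedyOrbit q n := by
  induction n with
  | zero => rfl
  | succ n ih => rw [frozenOrbit, ih, greedyOrbit_succ hq]

theorem continuous_frozenOrbit (q : ℝ) (n : ℕ) : Continuous fun q' => frozenOrbit q q' n := by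
  induction n with
  | zero => exact continuous_const
  | succ n ih => exact (continuous_id.mul ih).sub continuous_const

theorem greedyOrbit_eq_frozenOrbit {q q' : ℝ} {n : ℕ}
    (h : ∀ k < n, 0 ≤ frozenOrbit q q' (k + 1) ∧ frozenOrbit q q' (k + 1) < 1) :
    ∀ k ≤ n, greedyOrbit q' k = frozenOrbit q q' k := by
  intro k
  induction k with
  | zero => exact fun _ => rfl
  | succ k ih =>
    intro hk
    rw [greedyOrbit, ih (by omega), Int.fract_eq_iff]
    exact ⟨(h k hk).1, (h k hk).2, greedyDigit q k, by rw [frozenOrbit]; push_cast; ring⟩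

theorem le_frozenOrbit {q q' : ℝ} (hq : 1 < q) (h : q ≤ q') (n : ℕ) :
    greedyOrbit q n ≤ frozenOrbit q q' n := by
  induction n with
  | zero => exact le_rfl
  | succ n ih =>
    rw [greedyOrbit_succ hq, frozenOrbit]
    have := greedyOrbit_nonneg q n
    have : q * greedyOrbit q n ≤ q' * frozenOrbit q q' n := by gcongr; linarith
    linarith

theorem frozenOrbit_le {q q' : ℝ} (hq : 1 < q) (h : q' ≤ q) {n : ℕ}
    (hpos : ∀ k < n, 0 ≤ frozenOrbit q q' k) : frozenOrbit q q' n ≤ greedyOrbit q n := by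
  induction n with
  | zero => exact le_rfl
  | succ n ih =>
    rw [greedyOrbit_succ hq, frozenOrbit]
    have h1 := hpos n (by omega)
    have h2 := ih fun k hk => hpos k (by omega)
    have : q' * frozenOrbit q q' n ≤ q * greedyOrbit q n := by gcongr
    linarith

open Filter Topology in
/-- A limit from the right of univoque bases is univoque. In the limit the orbit of `1` stays
`≥ b₁`; if it hit `b₁`, then from there on it would be the mirror image of the orbit of `1`,
hence reach `1` as a left limit, that is, `0` under the greedy map. -/
theorem mem_univoqueBases_of_frequently_gt {M : ℕ} {q : ℝ} (hq : 1 < q) (hqM : q < M + 1)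
    (h : ∃ᶠ q' in 𝓝[>] q, q' ∈ univoqueBases M) : q ∈ univoqueBases M := by
  have hq1 : 0 < q - 1 := by linarith
  have hc : 0 < (M : ℝ) / (q - 1) - 1 := by
    rw [sub_pos, one_lt_div hq1]; linarith
  set L : ℝ := M / (q - 1) with hL
  have hLq : L * (q - 1) = M := by rw [hL]; field_simp
  have hge : ∀ n, L - 1 ≤ greedyOrbit q (n + 1) := by
    intro n
    by_contra hlt
    refine h ?_
    have h1 : ∀ᶠ q' in 𝓝 q, frozenOrbit q q' (n + 1) < M / (q' - 1) - 1 := by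
      refine ContinuousAt.eventually_lt (continuous_frozenOrbit q _).continuousAt ?_ ?_
      · exact (continuousAt_const.div (continuousAt_id.sub continuousAt_const) hq1.ne').sub
          continuousAt_const
      · rw [frozenOrbit_self hq]; exact not_le.1 hlt
    have h2 : ∀ᶠ q' in 𝓝 q, ∀ k ∈ Finset.range (n + 1), frozenOrbit q q' (k + 1) < 1 := by
      rw [Filter.eventually_all_finset]
      intro k _
      refine (continuous_frozenOrbit q _).continuousAt.eventually_lt continuousAt_const ?_
      rw [frozenOrbit_self hq]
      exact greedyOrbit_succ_lt q k
    have h3 : ∀ᶠ q' in 𝓝 q, q' < (M : ℝ) + 1 := eventually_lt_nhds hqM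
    filter_upwards [nhdsWithin_le_nhds h1, nhdsWithin_le_nhds h2, nhdsWithin_le_nhds h3,
      self_mem_nhdsWithin] with q' g1 g2 g3 g4 hU
    have g4' : q ≤ q' := le_of_lt g4
    have e := greedyOrbit_eq_frozenOrbit (n := n + 1) (fun k hk =>
      ⟨(greedyOrbit_nonneg q _).trans (le_frozenOrbit hq g4' (k + 1)), g2 k (by simpa using hk)⟩)
      (n + 1) le_rfl
    have := lt_greedyOrbit_of_mem g3 hU (k := n + 1) (by omega)
    linarith
  by_contra hnU
  have hex : ∃ p, greedyOrbit q (p + 1) ≤ L - 1 := by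
    by_contra hne
    exact hnU (mem_univoqueBases hq hqM fun k => not_le.1 fun h' => hne ⟨k, h'⟩)
  classical
  obtain ⟨p, hp, hmin⟩ : ∃ p, greedyOrbit q (p + 1) ≤ L - 1 ∧
      ∀ k < p, L - 1 < greedyOrbit q (k + 1) :=
    ⟨Nat.find hex, Nat.find_spec hex, fun k hk => not_le.1 (Nat.find_min hex hk)⟩
  have hpe : greedyOrbit q (p + 1) = L - 1 := le_antisymm hp (hge p)
  have hmir : ∀ k ≤ p, greedyOrbit q (p + 1 + k) = L - greedyOrbit q k := by
    intro k
    induction k with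
    | zero => intro _; rw [add_zero, hpe, greedyOrbit]
    | succ k ih =>
      intro hk
      have e := greedyOrbit_succ hq k
      have hD := greedyDigit_le hq hqM k
      rw [← add_assoc, greedyOrbit, ih (by omega), Int.fract_eq_iff]
      refine ⟨by linarith [greedyOrbit_le_one q (k + 1)], by linarith [hmin k (by omega)],
        (M : ℤ) - greedyDigit q k, ?_⟩
      push_cast
      rw [e]
      linear_combination hLq
  have hlast : greedyOrbit q (p + 1 + p + 1) = 0 := by
    rw [greedyOrbit, hmir p le_rfl, Int.fract_eq_iff]
    refine ⟨le_rfl, zero_lt_one, (M : ℤ) - greedyDigit q p + 1, ?_⟩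
    have e := greedyOrbit_succ hq p
    push_cast
    linear_combination hLq + e - hpe
  have := hge (p + 1 + p)
  linarith

open Filter Topology in
/-- If `q` is a limit from the left of univoque bases without being univoque, then the orbit of
`1` reaches `0` before it falls to `b₁` or below: otherwise the digits would be locally constant,
and the orbit of a nearby `q' < q` would be even lower, while `b₁` would be higher. -/
theorem exists_greedyOrbit_eq_zero {M : ℕ} {q : ℝ} (hq : 1 < q) (hqM : q < M + 1)
    (hnU : q ∉ univoqueBases M) (h : ∃ᶠ q' in 𝓝[<] q, q' ∈ univoqueBases M) :
    ∃ N, 1 ≤ N ∧ greedyOrbit q N = 0 ∧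
      ∀ k, 1 ≤ k → k < N → (M : ℝ) / (q - 1) - 1 < greedyOrbit q k := by
  have hq1 : 0 < q - 1 := by linarith
  have hM : (0 : ℝ) < M := by linarith
  have hex : ∃ p, greedyOrbit q (p + 1) ≤ M / (q - 1) - 1 := by
    by_contra hne
    exact hnU (mem_univoqueBases hq hqM fun k => not_le.1 fun h' => hne ⟨k, h'⟩)
  classical
  obtain ⟨p, hp, hmin⟩ : ∃ p, greedyOrbit q (p + 1) ≤ M / (q - 1) - 1 ∧
      ∀ k < p, M / (q - 1) - 1 < greedyOrbit q (k + 1) :=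
    ⟨Nat.find hex, Nat.find_spec hex, fun k hk => not_le.1 (Nat.find_min hex hk)⟩
  have hzero : ∃ k, k ≤ p ∧ greedyOrbit q (k + 1) = 0 := by
    by_contra hne
    push Not at hne
    refine h ?_
    have h1 : ∀ᶠ q' in 𝓝 q, ∀ k ∈ Finset.range (p + 1),
        0 < frozenOrbit q q' (k + 1) ∧ frozenOrbit q q' (k + 1) < 1 := by
      rw [Filter.eventually_all_finset]
      intro k hk
      have hk' : k ≤ p := by simpa [Nat.lt_succ_iff] using hk
      refine Filter.Eventually.and ?_ ?_
      · refine continuousAt_const.eventually_lt (continuous_frozenOrbit q _).continuousAt ?_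
        rw [frozenOrbit_self hq]
        exact lt_of_le_of_ne (greedyOrbit_nonneg q _) (hne k hk').symm
      · refine (continuous_frozenOrbit q _).continuousAt.eventually_lt continuousAt_const ?_
        rw [frozenOrbit_self hq]
        exact greedyOrbit_succ_lt q k
    have h2 : ∀ᶠ q' in 𝓝 q, 1 < q' := eventually_gt_nhds hq
    filter_upwards [nhdsWithin_le_nhds h1, nhdsWithin_le_nhds h2, self_mem_nhdsWithin]
      with q' g1 g2 g3 hU
    have g3' : q' < q := g3
    have e := greedyOrbit_eq_frozenOrbit (n := p + 1) (fun k hk =>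
      ⟨(g1 k (by simpa using hk)).1.le, (g1 k (by simpa using hk)).2⟩) (p + 1) le_rfl
    have h4 := frozenOrbit_le hq g3'.le (n := p + 1) fun k hk => by
      cases k with
      | zero => exact zero_le_one
      | succ k => exact (g1 k (by simp; omega)).1.le
    have h5 := lt_greedyOrbit_of_mem (by linarith) hU (k := p + 1) (by omega)
    have h6 : (M : ℝ) / (q - 1) < M / (q' - 1) :=
      div_lt_div_of_pos_left hM (by linarith) (by linarith)
    linarith
  obtain ⟨k, ⟨hk, hk0⟩, hkmin⟩ : ∃ k, (k ≤ p ∧ greedyOrbit q (k + 1) = 0) ∧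
      ∀ j < k, ¬(j ≤ p ∧ greedyOrbit q (j + 1) = 0) :=
    ⟨Nat.find hzero, Nat.find_spec hzero, fun j hj => Nat.find_min hzero hj⟩
  refine ⟨k + 1, by omega, hk0, fun j hj hjk => ?_⟩
  obtain ⟨i, rfl⟩ := Nat.exists_eq_add_of_le' hj
  exact hmin i (by omega)

open Filter Topology in
/-- The arithmetic of the bases in `closure 𝒰 \ 𝒰`: the greedy orbit of `1` ends in `0` and stays
above `b₁` until then. -/
theorem greedyOrbit_of_mem_closure_diff {M : ℕ} (hM : 1 ≤ M) {q : ℝ}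
    (hq : q ∈ closure (univoqueBases M) \ univoqueBases M) :
    1 < q ∧ q < M + 1 ∧ ∃ N, 1 ≤ N ∧ greedyOrbit q N = 0 ∧
      ∀ k, 1 ≤ k → k < N → (M : ℝ) / (q - 1) - 1 < greedyOrbit q k := by
  have hM' : (1 : ℝ) ≤ M := by exact_mod_cast hM
  obtain ⟨hcl, hnU⟩ := hq
  have hsub : univoqueBases M ⊆ Set.Icc 1 (M + 1) ∩ {q : ℝ | (M : ℝ) ≤ q ^ 2 - q} := fun x hx =>
    ⟨⟨hx.1.1.le, hx.1.2⟩, le_sq_sub_of_mem hM hx⟩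
  have hclosed : IsClosed (Set.Icc 1 ((M : ℝ) + 1) ∩ {q : ℝ | (M : ℝ) ≤ q ^ 2 - q}) :=
    isClosed_Icc.inter (isClosed_le continuous_const (by fun_prop))
  obtain ⟨⟨h1, h2⟩, h3⟩ := closure_minimal hsub hclosed hcl
  have h1' : 1 < q := by
    refine lt_of_le_of_ne h1 ?_
    rintro rfl
    have : (M : ℝ) ≤ 1 ^ 2 - 1 := h3
    linarith
  have h2' : q < M + 1 := by
    refine lt_of_le_of_ne h2 ?_
    rintro rfl
    exact hnU (succ_mem_univoqueBases hM)
  refine ⟨h1', h2', exists_greedyOrbit_eq_zero h1' h2' hnU ?_⟩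
  have hfr : ∃ᶠ q' in 𝓝 q, q' ∈ univoqueBases M := mem_closure_iff_frequently.1 hcl
  by_contra hleft
  refine hnU (mem_univoqueBases_of_frequently_gt h1' h2' fun hright => hfr ?_)
  rw [not_frequently] at hleft
  rw [← nhdsNE_sup_pure, ← nhdsLT_sup_nhdsGT, eventually_sup, eventually_sup, eventually_pure]
  exact ⟨⟨hleft, hright⟩, hnU⟩

/-! ### Components of open sets of reals -/

theorem exists_connectedComponentIn_eq_Ioo {D : Set ℝ} (hD : IsOpen D) (hb : BddBelow D)
    (ha : BddAbove D) {x : ℝ} (hx : x ∈ D) :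
    ∃ u v, connectedComponentIn D x = Set.Ioo u v ∧ u ∉ D ∧ v ∉ D := by
  set I := connectedComponentIn D x with hI
  have hsub : I ⊆ D := connectedComponentIn_subset D x
  have hxI : x ∈ I := mem_connectedComponentIn hx
  have hconn : IsConnected I := ⟨⟨x, hxI⟩, isPreconnected_connectedComponentIn⟩
  have hopen : IsOpen I := hD.connectedComponentIn
  have hbI := hb.mono hsub
  have haI := ha.mono hsub
  -- a point of `D` in the closure of the component belongs to it
  have hclos : ∀ y ∈ D, y ∈ closure I → y ∈ I := by
    intro y hy hyc
    obtain ⟨z, hz1, hz2⟩ := mem_closure_iff.1 hyc _ hD.connectedComponentIn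
      (mem_connectedComponentIn hy)
    rw [hI, connectedComponentIn_eq hz2, ← connectedComponentIn_eq hz1]
    exact mem_connectedComponentIn hy
  have hu : sInf I ∉ I := fun h => by
    obtain ⟨l, hl, hl2⟩ := (mem_nhdsLE_iff_exists_Ioc_subset).1
      (mem_nhdsWithin_of_mem_nhds (t := Set.Iic (sInf I)) (hopen.mem_nhds h))
    have hl' : l < sInf I := hl
    have := csInf_le hbI (hl2 (a := (l + sInf I) / 2) ⟨by linarith, by linarith⟩)
    linarith
  have hv : sSup I ∉ I := fun h => by
    obtain ⟨l, hl, hl2⟩ := (mem_nhdsGE_iff_exists_Ico_subset).1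
      (mem_nhdsWithin_of_mem_nhds (t := Set.Ici (sSup I)) (hopen.mem_nhds h))
    have hl' : sSup I < l := hl
    have := le_csSup haI (hl2 (a := (l + sSup I) / 2) ⟨by linarith, by linarith⟩)
    linarith
  refine ⟨sInf I, sSup I, ?_, ?_, ?_⟩
  · refine Set.Subset.antisymm (fun y hy => ⟨?_, ?_⟩) (hconn.Ioo_csInf_csSup_subset hbI haI)
    · exact lt_of_le_of_ne (csInf_le hbI hy) fun h => hu (h ▸ hy)
    · exact lt_of_le_of_ne (le_csSup haI hy) fun h => hv (h ▸ hy)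
  · exact fun h => hu (hclos _ h (csInf_mem_closure ⟨x, hxI⟩ hbI))
  · exact fun h => hv (hclos _ h (csSup_mem_closure ⟨x, hxI⟩ haI))

/-! ### Finite orbits and the domain of the graph -/

/-- The arithmetic data behind the graph. Here `a k` and `c + 1 - a k` are the points
`a_{k+1}` and `b_{k+1}`; in particular `b₁ = c`, `a₁ = 1`, and `c + 1 = M / (q - 1)` is the right
end of the domain. The orbit `a` reaches `0` at time `N` and stays in `(c, 1)` in between. -/
structure FiniteOrbit (M N : ℕ) (q c : ℝ) (β : ℕ → ℕ) (a : ℕ → ℝ) : Prop where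
  one_lt : 1 < q
  lt_succ : q < M + 1
  c_lt : c < 1
  top_eq : (M : ℝ) / (q - 1) = c + 1
  aPt_eq : ∀ k, aPt q β (k + 1) = a k
  one_le : 1 ≤ N
  digit_le : ∀ k, β k ≤ M
  a_zero : a 0 = 1
  a_succ : ∀ k, a (k + 1) = q * a k - β k
  a_last : a N = 0
  c_lt_a : ∀ k, k + 1 < N → c < a (k + 1)
  a_lt : ∀ k, k + 1 < N → a (k + 1) < 1

/-- The connected component of `x` in the domain of the graph. -/
def comp (M : ℕ) (q : ℝ) (β : ℕ → ℕ) (N : ℕ) (x : ℝ) : Set ℝ :=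
  connectedComponentIn (graphDomain M q β N) x

/-- The part of the domain of the graph inside `(b₁, a₁) = (c, 1)`: the union of the vertices of the
reduced graph. -/
def innerDomain (M : ℕ) (q : ℝ) (β : ℕ → ℕ) (N : ℕ) (c : ℝ) : Set ℝ :=
  graphDomain M q β N ∩ Set.Ioo c 1

namespace FiniteOrbit

variable {M N : ℕ} {q c : ℝ} {β : ℕ → ℕ} {a : ℕ → ℝ}

theorem q_pos (h : FiniteOrbit M N q c β a) : 0 < q := by linarith [h.one_lt]

theorem mul_top (h : FiniteOrbit M N q c β a) : q * (c + 1) = M + (c + 1) := by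
  have h1 : 0 < q - 1 := by linarith [h.one_lt]
  have h2 := h.top_eq
  rw [div_eq_iff h1.ne'] at h2
  linarith

theorem c_pos (h : FiniteOrbit M N q c β a) : 0 < c := by
  have h1 := h.mul_top
  nlinarith [h.one_lt, h.lt_succ]

theorem a_pos (h : FiniteOrbit M N q c β a) {k : ℕ} (hk : k < N) : c < a k := by
  cases k with
  | zero => rw [h.a_zero]; exact h.c_lt
  | succ k => exact h.c_lt_a k hk

theorem a_le (h : FiniteOrbit M N q c β a) {k : ℕ} (hk : k < N) : a k ≤ 1 := by
  cases k with
  | zero => rw [h.a_zero]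
  | succ k => exact (h.a_lt k hk).le

theorem mul_a (h : FiniteOrbit M N q c β a) (k : ℕ) : q * a k = β k + a (k + 1) := by
  linarith [h.a_succ k]

theorem mul_b (h : FiniteOrbit M N q c β a) (k : ℕ) :
    q * (c + 1 - a k) = (M - β k : ℕ) + (c + 1 - a (k + 1)) := by
  rw [Nat.cast_sub (h.digit_le k)]
  linarith [h.mul_a k, h.mul_top]

theorem mul_a_last (h : FiniteOrbit M N q c β a) {k : ℕ} (hk : k + 1 = N) : q * a k = β k := by
  rw [h.mul_a, hk, h.a_last, add_zero]

theorem digit_last_pos (h : FiniteOrbit M N q c β a) {k : ℕ} (hk : k + 1 = N) : 1 ≤ β k := by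
  have h1 := h.mul_a_last hk
  have h2 := h.a_pos (k := k) (by omega)
  have h3 : 0 < q * a k := mul_pos h.q_pos (h.c_pos.trans h2)
  rw [h1] at h3
  exact_mod_cast h3

theorem mul_b_last (h : FiniteOrbit M N q c β a) {k : ℕ} (hk : k + 1 = N) :
    q * (c + 1 - a k) = (M + 1 - β k : ℕ) + c := by
  rw [Nat.cast_sub ((h.digit_le k).trans (Nat.le_succ M))]
  push_cast
  linarith [h.mul_a_last hk, h.mul_top]

/-- The `l`-th switch interval is the preimage of `[0, c]` under `x ↦ q x - l`. -/
theorem mem_switchRegion (h : FiniteOrbit M N q c β a) {x : ℝ} :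
    x ∈ switchRegion M q ↔ ∃ l : ℕ, 1 ≤ l ∧ l ≤ M ∧ (l : ℝ) ≤ q * x ∧ q * x ≤ l + c := by
  have hq := h.q_pos
  have hq1 : 0 < q - 1 := by linarith [h.one_lt]
  have e : (M : ℝ) / (q ^ 2 - q) = (c + 1) / q := by
    rw [← h.top_eq]
    field_simp
  have e2 : ∀ l : ℕ, ((l : ℝ) - 1) / q + (M : ℝ) / (q ^ 2 - q) = (l + c) / q := fun l => by
    rw [e, ← add_div]; ring
  simp only [switchRegion, Set.mem_iUnion, Set.mem_Icc, exists_prop, e2, div_le_iff₀ hq,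
    le_div_iff₀ hq, mul_comm x q, and_assoc]

theorem mem_graphDomain (h : FiniteOrbit M N q c β a) {x : ℝ} :
    x ∈ graphDomain M q β N ↔ 0 < x ∧ x < c + 1 ∧ x ∉ switchRegion M q ∧
      ∀ k < N, x ≠ a k ∧ x ≠ c + 1 - a k := by
  simp only [graphDomain, h.top_eq, Set.mem_sdiff, Set.mem_Ioo, Set.mem_union, Set.mem_ofPred_eq,
    not_or, and_assoc, bPt]
  refine and_congr_right fun _ => and_congr_right fun _ => and_congr_right fun _ => ?_
  constructor
  · intro h1 k hk
    have h2 : ¬(x = aPt q β (k + 1) ∨ x = c + 1 - aPt q β (k + 1)) :=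
      fun h2 => h1 ⟨k + 1, ⟨by omega, by omega⟩, h2⟩
    rwa [h.aPt_eq, not_or] at h2
  · rintro h1 ⟨i, ⟨hi1, hi2⟩, hi⟩
    obtain ⟨k, rfl⟩ := Nat.exists_eq_add_of_le' hi1
    rw [h.aPt_eq] at hi
    exact hi.elim (h1 k (by omega)).1 (h1 k (by omega)).2

theorem a_notMem (h : FiniteOrbit M N q c β a) {k : ℕ} (hk : k < N) :
    a k ∉ graphDomain M q β N := fun hx => ((h.mem_graphDomain.1 hx).2.2.2 k hk).1 rfl

theorem b_notMem (h : FiniteOrbit M N q c β a) {k : ℕ} (hk : k < N) :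
    c + 1 - a k ∉ graphDomain M q β N := fun hx => ((h.mem_graphDomain.1 hx).2.2.2 k hk).2 rfl

theorem one_notMem (h : FiniteOrbit M N q c β a) : (1 : ℝ) ∉ graphDomain M q β N := by
  rw [← h.a_zero]; exact h.a_notMem h.one_le

theorem c_notMem (h : FiniteOrbit M N q c β a) : c ∉ graphDomain M q β N := by
  have := h.b_notMem (k := 0) h.one_le
  rwa [h.a_zero, add_sub_cancel_right] at this

theorem isClosed_switchRegion (M : ℕ) (q : ℝ) : IsClosed (switchRegion M q) :=
  (Set.finite_Icc 1 M).isClosed_biUnion fun _ _ => isClosed_Icc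

theorem isOpen_graphDomain (M : ℕ) (q : ℝ) (β : ℕ → ℕ) (N : ℕ) : IsOpen (graphDomain M q β N) := by
  refine isOpen_Ioo.sdiff ((isClosed_switchRegion M q).union (Set.Finite.isClosed ?_))
  refine (((Set.finite_Icc 1 N).image (aPt q β)).union
    ((Set.finite_Icc 1 N).image (bPt M q β))).subset ?_
  rintro x ⟨i, hi, rfl | rfl⟩
  · exact Or.inl ⟨i, hi, rfl⟩
  · exact Or.inr ⟨i, hi, rfl⟩

/-- Points whose image under some `x ↦ q x - d` lies in `(c, 1)` are outside the switch region. -/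
theorem notMem_switchRegion (h : FiniteOrbit M N q c β a) {x : ℝ} {d : ℕ} (h1 : c < q * x - d)
    (h2 : q * x - d < 1) : x ∉ switchRegion M q := by
  rw [h.mem_switchRegion]
  rintro ⟨l, -, -, hl1, hl2⟩
  have h3 : (l : ℝ) < d + 1 := by linarith
  have h4 : (d : ℝ) < l := by linarith
  have h5 : l < d + 1 := by exact_mod_cast h3
  have h6 : d < l := by exact_mod_cast h4
  omega

theorem a_notMem_switchRegion (h : FiniteOrbit M N q c β a) {k : ℕ} (hk : k + 1 < N) :
    a k ∉ switchRegion M q := by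
  apply h.notMem_switchRegion (d := β k) <;> rw [← h.a_succ]
  exacts [h.c_lt_a k hk, h.a_lt k hk]

theorem b_notMem_switchRegion (h : FiniteOrbit M N q c β a) {k : ℕ} (hk : k + 1 < N) :
    c + 1 - a k ∉ switchRegion M q := by
  have h1 := h.c_lt_a k hk
  have h2 := h.a_lt k hk
  have h3 := h.mul_b k
  apply h.notMem_switchRegion (d := M - β k) <;> linarith

theorem notMem_switchRegion_symm (h : FiniteOrbit M N q c β a) {x : ℝ}
    (hx : x ∉ switchRegion M q) : c + 1 - x ∉ switchRegion M q := by
  rw [h.mem_switchRegion] at hx ⊢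
  rintro ⟨l, hl1, hl2, hl3, hl4⟩
  have e : ((M + 1 - l : ℕ) : ℝ) = M + 1 - l := by
    rw [Nat.cast_sub (by omega)]; push_cast; ring
  have := h.mul_top
  exact hx ⟨M + 1 - l, by omega, by omega, by rw [e]; linarith, by rw [e]; linarith⟩

theorem mem_graphDomain_symm (h : FiniteOrbit M N q c β a) {x : ℝ}
    (hx : x ∈ graphDomain M q β N) : c + 1 - x ∈ graphDomain M q β N := by
  rw [h.mem_graphDomain] at hx ⊢
  obtain ⟨h1, h2, h3, h4⟩ := hx
  refine ⟨by linarith, by linarith, h.notMem_switchRegion_symm h3, fun k hk => ⟨?_, ?_⟩⟩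
  · intro e; exact (h4 k hk).2 (by linarith)
  · intro e; exact (h4 k hk).1 (by linarith)

theorem mem_innerDomain_symm (h : FiniteOrbit M N q c β a) {x : ℝ}
    (hx : x ∈ innerDomain M q β N c) : c + 1 - x ∈ innerDomain M q β N c :=
  ⟨h.mem_graphDomain_symm hx.1, by linarith [hx.2.2], by linarith [hx.2.1]⟩

/-- The domain is backward invariant: every preimage of a point of the domain in `(c, 1)` under one
of the maps `x ↦ q x - j` lies in the domain. -/
theorem mem_graphDomain_of_mul_sub (h : FiniteOrbit M N q c β a) {y : ℝ} {j : ℕ} (hj : j ≤ M)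
    (hy : q * y - j ∈ innerDomain M q β N c) : y ∈ graphDomain M q β N := by
  obtain ⟨hD, hc, h1⟩ := hy
  have hq := h.q_pos
  have hc0 := h.c_pos
  have hj' : (j : ℝ) ≤ M := by exact_mod_cast hj
  have hj0 : (0 : ℝ) ≤ j := j.cast_nonneg
  rw [h.mem_graphDomain]
  refine ⟨?_, ?_, h.notMem_switchRegion hc h1, fun k hk => ⟨?_, ?_⟩⟩
  · by_contra hcon
    nlinarith
  · by_contra hcon
    have := h.mul_top
    nlinarith
  · rintro rfl
    have e := h.mul_a k
    rcases (show k + 1 < N ∨ k + 1 = N by omega) with hk' | hk'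
    · have g1 := h.c_lt_a k hk'
      have g2 := h.a_lt k hk'
      have h3 : (β k : ℝ) < j + 1 := by linarith
      have h4 : (j : ℝ) < β k + 1 := by linarith
      have h5 : β k < j + 1 := by exact_mod_cast h3
      have h6 : j < β k + 1 := by exact_mod_cast h4
      have h7 : j = β k := by omega
      rw [h7, ← h.a_succ] at hD
      exact h.a_notMem hk' hD
    · rw [hk', h.a_last] at e
      have h3 : (β k : ℝ) < j + 1 := by linarith
      have h4 : (j : ℝ) < β k := by linarith
      have h5 : β k < j + 1 := by exact_mod_cast h3
      have h6 : j < β k := by exact_mod_cast h4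
      omega
  · rintro rfl
    rcases (show k + 1 < N ∨ k + 1 = N by omega) with hk' | hk'
    · have e := h.mul_b k
      have g1 := h.c_lt_a k hk'
      have g2 := h.a_lt k hk'
      have h3 : ((M - β k : ℕ) : ℝ) < j + 1 := by linarith
      have h4 : (j : ℝ) < (M - β k : ℕ) + 1 := by linarith
      have h5 : M - β k < j + 1 := by exact_mod_cast h3
      have h6 : j < M - β k + 1 := by exact_mod_cast h4
      have h7 : j = M - β k := by omega
      have h8 : q * (c + 1 - a k) - j = c + 1 - a (k + 1) := by rw [h7]; linarith
      rw [h8] at hD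
      exact h.b_notMem hk' hD
    · have e := h.mul_b_last hk'
      have h3 : ((M + 1 - β k : ℕ) : ℝ) < j + 1 := by linarith
      have h4 : (j : ℝ) < (M + 1 - β k : ℕ) := by linarith
      have h5 : M + 1 - β k < j + 1 := by exact_mod_cast h3
      have h6 : j < M + 1 - β k := by exact_mod_cast h4
      omega

/-! ### Vertices and edges of the reduced graph -/

theorem comp_subset (h : FiniteOrbit M N q c β a) {x : ℝ} (hx : x ∈ innerDomain M q β N c) :
    comp M q β N x ⊆ innerDomain M q β N c := by
  intro y hy
  have hsub : comp M q β N x ⊆ graphDomain M q β N := connectedComponentIn_subset _ _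
  have hxI : x ∈ comp M q β N x := mem_connectedComponentIn hx.1
  have hord : (comp M q β N x).OrdConnected :=
    (isPreconnected_connectedComponentIn).ordConnected
  refine ⟨hsub hy, ?_, ?_⟩
  · by_contra hle
    exact h.c_notMem (hsub (hord.out hy hxI ⟨not_lt.1 hle, hx.2.1.le⟩))
  · by_contra hle
    exact h.one_notMem (hsub (hord.out hxI hy ⟨hx.2.2.le, not_lt.1 hle⟩))

theorem mem_verts_iff (h : FiniteOrbit M N q c β a) {V : Set ℝ} :
    V ∈ (reducedGraph M q β N).verts ↔ ∃ x ∈ innerDomain M q β N c, V = comp M q β N x := by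
  have ea : aPt q β 1 = 1 := by rw [h.aPt_eq 0, h.a_zero]
  have eb : bPt M q β 1 = c := by rw [bPt, ea, h.top_eq, add_sub_cancel_right]
  change (V ∈ graphVertices M q β N ∧ V ⊆ Set.Ioo (bPt M q β 1) (aPt q β 1)) ↔ _
  rw [ea, eb]
  constructor
  · rintro ⟨⟨x, hx, rfl⟩, hV⟩
    exact ⟨x, ⟨hx, hV (mem_connectedComponentIn hx)⟩, rfl⟩
  · rintro ⟨x, hx, rfl⟩
    exact ⟨⟨x, hx.1, rfl⟩, fun y hy => (h.comp_subset hx hy).2⟩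

/-- There is an edge from `I` to `J` as soon as the image of `I` meets `J`. -/
theorem step_iff (h : FiniteOrbit M N q c β a) {I J : Set ℝ} :
    (reducedGraph M q β N).Step I J ↔ ∃ x j, j ≤ M ∧ x ∈ innerDomain M q β N c ∧
      q * x - (j : ℕ) ∈ innerDomain M q β N c ∧ I = comp M q β N x ∧
      J = comp M q β N (q * x - j) := by
  constructor
  · rintro ⟨j, hj⟩
    have hI : I ∈ (reducedGraph M q β N).verts := (reducedGraph M q β N).source_mem _ hj
    have hJ : J ∈ (reducedGraph M q β N).verts := (reducedGraph M q β N).target_mem _ hj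
    obtain ⟨x, hx, rfl⟩ := h.mem_verts_iff.1 hI
    obtain ⟨y, hy, rfl⟩ := h.mem_verts_iff.1 hJ
    obtain ⟨z, hz, e⟩ := hj.1.2.2.2 (mem_connectedComponentIn hy.1)
    replace e : q * z - j = y := e
    subst e
    exact ⟨z, j, hj.1.2.2.1, h.comp_subset hx hz, hy, connectedComponentIn_eq hz, rfl⟩
  · rintro ⟨x, j, hj, hx, hy, rfl, rfl⟩
    have hI := h.mem_verts_iff.2 ⟨x, hx, rfl⟩
    have hJ := h.mem_verts_iff.2 ⟨_, hy, rfl⟩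
    refine ⟨j, ⟨hI.1, hJ.1, hj, ?_⟩, hI.2, hJ.2⟩
    intro z hz
    have hq := h.q_pos
    -- the preimage of the component of `q x - j` is a connected part of the domain
    have hpre : (fun z => (z + j) / q) '' comp M q β N (q * x - j) ⊆ comp M q β N x := by
      refine IsPreconnected.subset_connectedComponentIn ?_ ?_ ?_
      · exact isPreconnected_connectedComponentIn.image _
          (Continuous.continuousOn (by fun_prop))
      · exact ⟨_, mem_connectedComponentIn hy.1, by field_simp; ring⟩
      · rintro _ ⟨w, hw, rfl⟩
        refine h.mem_graphDomain_of_mul_sub hj ?_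
        have e : q * ((w + j) / q) - j = w := by field_simp; ring
        simp only [e]
        exact h.comp_subset hy hw
    exact ⟨_, hpre ⟨z, hz, rfl⟩, by field_simp; ring⟩

theorem image_comp (h : FiniteOrbit M N q c β a) {x : ℝ} (hx : x ∈ graphDomain M q β N) :
    (fun x => c + 1 - x) '' comp M q β N x = comp M q β N (c + 1 - x) := by
  have e := (Homeomorph.subLeft (c + 1)).image_connectedComponentIn hx
  have e2 : (Homeomorph.subLeft (c + 1)) '' graphDomain M q β N = graphDomain M q β N := by
    ext y
    constructor
    · rintro ⟨z, hz, rfl⟩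
      exact h.mem_graphDomain_symm hz
    · intro hy
      exact ⟨_, h.mem_graphDomain_symm hy, by simp⟩
  rw [e2] at e
  exact e

theorem step_symm (h : FiniteOrbit M N q c β a) {I J : Set ℝ}
    (hs : (reducedGraph M q β N).Step I J) :
    (reducedGraph M q β N).Step ((fun x => c + 1 - x) '' I) ((fun x => c + 1 - x) '' J) := by
  obtain ⟨x, j, hj, hx, hy, rfl, rfl⟩ := h.step_iff.1 hs
  have e : q * (c + 1 - x) - (M - j : ℕ) = c + 1 - (q * x - j) := by
    rw [Nat.cast_sub hj]
    linarith [h.mul_top]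
  refine h.step_iff.2 ⟨c + 1 - x, M - j, Nat.sub_le _ _, h.mem_innerDomain_symm hx, ?_,
    h.image_comp hx.1, ?_⟩
  · rw [e]; exact h.mem_innerDomain_symm hy
  · rw [e]; exact h.image_comp hy.1

/-! ### Right germs of components -/

open Filter Topology

/-- The component of `x` contains a right neighbourhood of `u`; for `u` outside the domain this says
that `u` is the left endpoint of the component. -/
def RightGerm (M : ℕ) (q : ℝ) (β : ℕ → ℕ) (N : ℕ) (u x : ℝ) : Prop :=
  ∀ᶠ y in 𝓝[>] u, y ∈ comp M q β N x

theorem step_of_rightGerm (h : FiniteOrbit M N q c β a) {u w x z : ℝ} {j : ℕ} (hj : j ≤ M)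
    (hx : x ∈ innerDomain M q β N c) (hz : z ∈ innerDomain M q β N c)
    (hux : RightGerm M q β N u x) (hw : q * u = j + w) (hwz : RightGerm M q β N w z) :
    (reducedGraph M q β N).Step (comp M q β N x) (comp M q β N z) := by
  have ht : Tendsto (fun y => q * y - j) (𝓝[>] u) (𝓝[>] w) := by
    have e : w = q * u - j := by linarith
    rw [e]
    refine tendsto_nhdsWithin_iff.2 ⟨?_, ?_⟩
    · exact (Continuous.tendsto (by fun_prop) u).mono_left nhdsWithin_le_nhds
    · filter_upwards [self_mem_nhdsWithin] with y hy
      have := mul_lt_mul_of_pos_left (show u < y from hy) h.q_pos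
      simp only [Set.mem_Ioi]
      linarith
  obtain ⟨y, hy1, hy2⟩ := (hux.and (ht.eventually hwz)).exists
  exact h.step_iff.2 ⟨y, j, hj, h.comp_subset hx hy1, h.comp_subset hz hy2,
    connectedComponentIn_eq hy1, connectedComponentIn_eq hy2⟩

theorem exists_rightGerm (h : FiniteOrbit M N q c β a) {u : ℝ} (hcu : c ≤ u) (hu1 : u < 1)
    (hS : ∀ᶠ y in 𝓝[>] u, y ∉ switchRegion M q) :
    ∃ x ∈ innerDomain M q β N c, RightGerm M q β N u x := by
  have hne : ∀ p : ℝ, ∀ᶠ y in 𝓝[>] u, y ≠ p := by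
    intro p
    rcases le_or_gt p u with hp | hp
    · filter_upwards [self_mem_nhdsWithin] with y hy
      exact (hp.trans_lt hy).ne'
    · filter_upwards [nhdsWithin_le_nhds (eventually_lt_nhds hp)] with y hy
      exact hy.ne
  have hfin : ∀ᶠ y in 𝓝[>] u, ∀ k ∈ Finset.range N, y ≠ a k ∧ y ≠ c + 1 - a k := by
    rw [Filter.eventually_all_finset]
    exact fun k _ => (hne _).and (hne _)
  have hlt : ∀ᶠ y in 𝓝[>] u, y < 1 := nhdsWithin_le_nhds (eventually_lt_nhds hu1)
  have hD : ∀ᶠ y in 𝓝[>] u, y ∈ innerDomain M q β N c := by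
    filter_upwards [hS, hfin, hlt, self_mem_nhdsWithin] with y h1 h2 h3 h4
    have h4' : u < y := h4
    have hc := h.c_pos
    refine ⟨h.mem_graphDomain.2 ⟨by linarith, by linarith, h1, fun k hk => h2 k (by simpa)⟩,
      by linarith, h3⟩
  obtain ⟨w, hw, hsub⟩ := mem_nhdsGT_iff_exists_Ioo_subset.1 hD
  have hw' : u < w := hw
  have hm : (u + w) / 2 ∈ Set.Ioo u w := ⟨by linarith, by linarith⟩
  refine ⟨(u + w) / 2, hsub hm, ?_⟩
  have hcomp : Set.Ioo u w ⊆ comp M q β N ((u + w) / 2) :=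
    isPreconnected_Ioo.subset_connectedComponentIn hm fun y hy => (hsub hy).1
  exact mem_of_superset (Ioo_mem_nhdsGT hw') hcomp

theorem eventually_notMem_switchRegion {u : ℝ} (hu : u ∉ switchRegion M q) :
    ∀ᶠ y in 𝓝[>] u, y ∉ switchRegion M q :=
  nhdsWithin_le_nhds ((isClosed_switchRegion M q).isOpen_compl.mem_nhds hu)

/-- Just to the right of the right endpoint of a switch interval there is a gap. -/
theorem eventually_notMem_switchRegion_of_eq (h : FiniteOrbit M N q c β a) {u : ℝ} {l : ℕ}
    (hu : q * u = l + c) : ∀ᶠ y in 𝓝[>] u, y ∉ switchRegion M q := by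
  have h1 : ∀ᶠ y in 𝓝 u, q * y < l + 1 := by
    refine (Continuous.continuousAt (by fun_prop)).eventually_lt continuousAt_const ?_
    linarith [h.c_lt]
  filter_upwards [nhdsWithin_le_nhds h1, self_mem_nhdsWithin] with y h2 h3
  have h4 := mul_lt_mul_of_pos_left (show u < y from h3) h.q_pos
  exact h.notMem_switchRegion (d := l) (by linarith) (by linarith)

theorem exists_rightGerm_b (h : FiniteOrbit M N q c β a) {k : ℕ} (hk : k < N) :
    ∃ x ∈ innerDomain M q β N c, RightGerm M q β N (c + 1 - a k) x := by
  have h1 := h.a_pos hk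
  have h2 := h.a_le hk
  refine h.exists_rightGerm (by linarith) (by linarith) ?_
  rcases (show k + 1 < N ∨ k + 1 = N by omega) with hk' | hk'
  · exact eventually_notMem_switchRegion (h.b_notMem_switchRegion hk')
  · exact h.eventually_notMem_switchRegion_of_eq (h.mul_b_last hk')

/-! ### Every vertex leads to the leftmost vertex -/

/-- A component whose left endpoint is the right end `(l + c) / q` of a switch interval has an edge
to the leftmost vertex `(c, ·)`. -/
theorem step_leftmost (h : FiniteOrbit M N q c β a) {z₀ : ℝ} (hz₀ : z₀ ∈ innerDomain M q β N c)
    (hg : RightGerm M q β N c z₀) {u x : ℝ} (hx : x ∈ innerDomain M q β N c)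
    (hux : RightGerm M q β N u x) {l : ℕ} (hl : l ≤ M) (hu : q * u = l + c) :
    (reducedGraph M q β N).Step (comp M q β N x) (comp M q β N z₀) :=
  h.step_of_rightGerm hl hx hz₀ hux hu hg

theorem reach_leftmost_of_b (h : FiniteOrbit M N q c β a) {z₀ : ℝ}
    (hz₀ : z₀ ∈ innerDomain M q β N c) (hg : RightGerm M q β N c z₀) (m : ℕ) :
    ∀ {k : ℕ}, k + 1 + m = N → ∀ {x : ℝ}, x ∈ innerDomain M q β N c →
      RightGerm M q β N (c + 1 - a k) x →
      Relation.TransGen (reducedGraph M q β N).Step (comp M q β N x) (comp M q β N z₀) := by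
  induction m with
  | zero =>
    intro k hk x hx hux
    have hl : M + 1 - β k ≤ M := by
      have := h.digit_last_pos hk
      omega
    exact .single (h.step_leftmost hz₀ hg hx hux hl (h.mul_b_last hk))
  | succ m ih =>
    intro k hk x hx hux
    obtain ⟨y, hy, huy⟩ := h.exists_rightGerm_b (k := k + 1) (by omega)
    exact .head (h.step_of_rightGerm (Nat.sub_le _ _) hx hy hux (h.mul_b k) huy)
      (ih (by omega) hy huy)

/-- The image of a component with left endpoint `a_{N-1}` starts at `a_N`, the left end of a switch
interval, and reaches beyond the right end of that interval. Otherwise the component would be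
`(a_{N-1}, b_{N-1})` and its image the interior of the switch interval; by symmetry, `M` would be
twice the digit of the former and `M + 1` twice the index of the latter. -/
theorem mem_comp_of_penultimate (h : FiniteOrbit M N q c β a) {k : ℕ} (hk : k + 2 = N) {x : ℝ}
    (hx : x ∈ innerDomain M q β N c) (hux : RightGerm M q β N (a k) x) {y : ℝ}
    (hy : q * (q * y - β k) = β (k + 1) + c) : y ∈ comp M q β N x := by
  have hq := h.q_pos
  have hc := h.c_pos
  obtain ⟨u, v, hI, huD, hvD⟩ := exists_connectedComponentIn_eq_Ioo (isOpen_graphDomain M q β N)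
    ⟨0, fun z hz => hz.1.1.le⟩ ⟨_, fun z hz => hz.1.2.le⟩ hx.1
  change comp M q β N x = Set.Ioo u v at hI
  have hsub := h.comp_subset hx
  rw [RightGerm, hI] at hux
  have hxI : x ∈ comp M q β N x := mem_connectedComponentIn hx.1
  have huv : u < v := by rw [hI] at hxI; exact hxI.1.trans hxI.2
  have hu : u ≤ a k := by
    by_contra hlt
    obtain ⟨z, hz1, hz2⟩ := (hux.and (nhdsWithin_le_nhds (eventually_lt_nhds (not_le.1 hlt)))).exists
    exact lt_asymm hz2 hz1.1
  have hv : a k < v := by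
    obtain ⟨z, hz1, hz2⟩ := (hux.and self_mem_nhdsWithin).exists
    exact lt_trans hz2 hz1.2
  have hv1 : v ≤ 1 := by
    by_contra hlt
    have hm : (max u 1 + v) / 2 ∈ comp M q β N x := by
      have h1 : max u 1 < v := max_lt huv (not_le.1 hlt)
      rw [hI]
      exact ⟨by linarith [le_max_left u 1], by linarith⟩
    have := (hsub hm).2.2
    linarith [le_max_right u 1]
  have ha1 := h.mul_a_last (k := k + 1) (by omega)
  have ha0 := h.mul_a k
  have hlow := h.c_lt_a k (by omega)
  have hup := h.a_lt k (by omega)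
  rw [hI]
  refine ⟨?_, ?_⟩
  · refine hu.trans_lt ?_
    by_contra hle
    have h1 : q * y ≤ q * a k := mul_le_mul_of_nonneg_left (not_lt.1 hle) hq.le
    have h2 : q * (q * y - β k) ≤ q * a (k + 1) :=
      mul_le_mul_of_nonneg_left (by linarith) hq.le
    linarith
  by_contra hle
  -- `w` is the right end of the image; it lies in the switch interval with left end `a_N`
  set w := q * v - β k with hw
  have hw1 : a (k + 1) < w := by
    have := mul_lt_mul_of_pos_left hv hq
    linarith
  have hw2 : q * w ≤ β (k + 1) + c := by
    rw [← hy]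
    refine mul_le_mul_of_nonneg_left ?_ hq.le
    have := mul_le_mul_of_nonneg_left (not_lt.1 hle) hq.le
    linarith
  have hw3 : q * a (k + 1) < q * w := mul_lt_mul_of_pos_left hw1 hq
  have hwS : w ∈ switchRegion M q := h.mem_switchRegion.2
    ⟨β (k + 1), h.digit_last_pos (by omega), h.digit_le _, by linarith, hw2⟩
  have hwlt : w < 1 := by
    by_contra hge
    have h1 : q * 1 ≤ q * w := mul_le_mul_of_nonneg_left (not_lt.1 hge) hq.le
    have h2 : q * a (k + 1) ≤ q * 1 := mul_le_mul_of_nonneg_left hup.le hq.le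
    have h3 := h.a_notMem_switchRegion (k := 0) (by omega)
    rw [h.a_zero] at h3
    exact h3 (h.mem_switchRegion.2
      ⟨β (k + 1), h.digit_last_pos (by omega), h.digit_le _, by linarith, by linarith⟩)
  have hvS : v ∉ switchRegion M q := h.notMem_switchRegion (d := β k) (by linarith) hwlt
  have hvc : c < v := (h.a_pos (k := k) (by omega)).trans hv
  have hvA : ¬∀ i < N, v ≠ a i ∧ v ≠ c + 1 - a i := fun hA =>
    hvD (h.mem_graphDomain.2 ⟨by linarith, by linarith, hvS, hA⟩)
  have hvA' : ∃ i < N, v = a i ∨ v = c + 1 - a i := by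
    by_contra hne
    push Not at hne
    exact hvA hne
  obtain ⟨i, hi, hvi⟩ := hvA'
  have hi1 : i + 1 < N := by
    by_contra hcon
    have hi' : i + 1 = N := by omega
    refine hvS (h.mem_switchRegion.2 ?_)
    rcases hvi with rfl | rfl
    · exact ⟨β i, h.digit_last_pos hi', h.digit_le _, (h.mul_a_last hi').ge,
        by linarith [h.mul_a_last hi']⟩
    · have h1 := h.digit_last_pos hi'
      have h2 := h.digit_le i
      exact ⟨M + 1 - β i, by omega, by omega, by linarith [h.mul_b_last hi'],
        (h.mul_b_last hi').le⟩
  have g1 := h.c_lt_a i hi1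
  have g2 := h.a_lt i hi1
  rcases hvi with hvi | hvi
  · have e := h.mul_a i
    rw [← hvi] at e
    have h3 : (β i : ℝ) < β k + 1 := by linarith
    have h4 : (β k : ℝ) < β i + 1 := by linarith
    have h5 : β i < β k + 1 := by exact_mod_cast h3
    have h6 : β k < β i + 1 := by exact_mod_cast h4
    have h7 : β i = β k := by omega
    have h8 : w = a (i + 1) := by rw [hw, ← h7]; linarith
    rcases (show i + 1 + 1 < N ∨ i + 1 + 1 = N by omega) with hi2 | hi2
    · rw [h8] at hwS
      exact h.a_notMem_switchRegion hi2 hwS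
    · have : i = k := by omega
      rw [h8, this] at hw1
      exact lt_irrefl _ hw1
  · have e := h.mul_b i
    rw [← hvi] at e
    have h3 : ((M - β i : ℕ) : ℝ) < β k + 1 := by linarith
    have h4 : (β k : ℝ) < (M - β i : ℕ) + 1 := by linarith
    have h5 : M - β i < β k + 1 := by exact_mod_cast h3
    have h6 : β k < M - β i + 1 := by exact_mod_cast h4
    have h7 : M - β i = β k := by omega
    have h8 : w = c + 1 - a (i + 1) := by rw [hw, ← h7]; linarith
    rcases (show i + 1 + 1 < N ∨ i + 1 + 1 = N by omega) with hi2 | hi2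
    · rw [h8] at hwS
      exact h.b_notMem_switchRegion hi2 hwS
    · have hik : i = k := by omega
      have hbl := h.mul_b_last hi2
      rw [← h8, hik] at hbl
      have h9 : ((M + 1 - β (k + 1) : ℕ) : ℝ) ≤ β (k + 1) := by linarith
      have h10 : (β (k + 1) : ℝ) < (M + 1 - β (k + 1) : ℕ) + 1 := by linarith [h.c_lt]
      have h11 : M + 1 - β (k + 1) ≤ β (k + 1) := by exact_mod_cast h9
      have h12 : β (k + 1) < M + 1 - β (k + 1) + 1 := by exact_mod_cast h10
      have h13 := h.digit_le (k + 1)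
      have h14 := h.digit_le k
      rw [hik] at h7
      omega

theorem reach_leftmost_of_a (h : FiniteOrbit M N q c β a) {z₀ : ℝ}
    (hz₀ : z₀ ∈ innerDomain M q β N c) (hg : RightGerm M q β N c z₀) (m : ℕ) :
    ∀ {k : ℕ}, k + 2 + m = N → ∀ {x : ℝ}, x ∈ innerDomain M q β N c →
      RightGerm M q β N (a k) x →
      Relation.TransGen (reducedGraph M q β N).Step (comp M q β N x) (comp M q β N z₀) := by
  induction m with
  | zero =>
    intro k hk x hx hux
    have hq := h.q_pos
    -- `y` is mapped to the right end `w` of the switch interval that starts at `a_N`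
    set w : ℝ := (β (k + 1) + c) / q with hw
    have hqw : q * w = β (k + 1) + c := by rw [hw]; field_simp
    set y : ℝ := (β k + w) / q with hy
    have hqy : q * y = β k + w := by rw [hy]; field_simp
    have hyI : y ∈ comp M q β N x := h.mem_comp_of_penultimate hk hx hux (by
      rw [hqy, add_sub_cancel_left, hqw])
    have hyg : RightGerm M q β N y x :=
      nhdsWithin_le_nhds ((isOpen_graphDomain M q β N).connectedComponentIn.mem_nhds hyI)
    have hlow := h.c_lt_a k (by omega)
    have hal := h.mul_a_last (k := k + 1) (by omega)
    have hcw : c ≤ w := by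
      have : q * a (k + 1) ≤ q * w := by linarith [h.c_pos]
      have := le_of_mul_le_mul_left this hq
      linarith
    have hw1 : w < 1 := by
      by_contra hge
      have h1 : q * 1 ≤ q * w := mul_le_mul_of_nonneg_left (not_lt.1 hge) hq.le
      have h2 : q * a (k + 1) ≤ q * 1 :=
        mul_le_mul_of_nonneg_left (h.a_lt k (by omega)).le hq.le
      have h3 := h.a_notMem_switchRegion (k := 0) (by omega)
      rw [h.a_zero] at h3
      exact h3 (h.mem_switchRegion.2
        ⟨β (k + 1), h.digit_last_pos (by omega), h.digit_le _, by linarith, by linarith⟩)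
    obtain ⟨z, hz, hwz⟩ := h.exists_rightGerm hcw hw1
      (h.eventually_notMem_switchRegion_of_eq hqw)
    exact .head (h.step_of_rightGerm (h.digit_le k) hx hz hyg hqy hwz)
      (.single (h.step_leftmost hz₀ hg hz hwz (h.digit_le _) hqw))
  | succ m ih =>
    intro k hk x hx hux
    obtain ⟨y, hy, huy⟩ := h.exists_rightGerm (u := a (k + 1)) (h.c_lt_a k (by omega)).le
      (h.a_lt k (by omega)) (eventually_notMem_switchRegion (h.a_notMem_switchRegion (by omega)))
    exact .head (h.step_of_rightGerm (h.digit_le k) hx hy hux (h.mul_a k) huy)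
      (ih (by omega) hy huy)

theorem reach_leftmost (h : FiniteOrbit M N q c β a) {z₀ : ℝ}
    (hz₀ : z₀ ∈ innerDomain M q β N c) (hg : RightGerm M q β N c z₀) {x : ℝ}
    (hx : x ∈ innerDomain M q β N c) :
    Relation.TransGen (reducedGraph M q β N).Step (comp M q β N x) (comp M q β N z₀) := by
  obtain ⟨u, v, hI, huD, -⟩ := exists_connectedComponentIn_eq_Ioo (isOpen_graphDomain M q β N)
    ⟨0, fun z hz => hz.1.1.le⟩ ⟨_, fun z hz => hz.1.2.le⟩ hx.1
  change comp M q β N x = Set.Ioo u v at hI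
  have hsub := h.comp_subset hx
  have hxI : x ∈ Set.Ioo u v := hI ▸ mem_connectedComponentIn hx.1
  have hux : RightGerm M q β N u x := by
    rw [RightGerm, hI]
    exact Ioo_mem_nhdsGT (hxI.1.trans hxI.2)
  have hcu : c ≤ u := by
    by_contra hlt
    have h1 : u < min c v := lt_min (not_le.1 hlt) (hxI.1.trans hxI.2)
    have hm : (u + min c v) / 2 ∈ comp M q β N x := by
      rw [hI]
      exact ⟨by linarith, by linarith [min_le_right c v]⟩
    have := (hsub hm).2.1
    linarith [min_le_left c v]
  have hu1 : u < 1 := hxI.1.trans hx.2.2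
  have hc := h.c_pos
  by_cases huS : u ∈ switchRegion M q
  · obtain ⟨l, hl1, hl2, hl3, hl4⟩ := h.mem_switchRegion.1 huS
    rcases hl4.lt_or_eq with hlt | heq
    · -- otherwise points of the component would lie in the switch region
      exfalso
      have h1 : ∀ᶠ y in 𝓝 u, q * y < l + c :=
        (Continuous.continuousAt (by fun_prop)).eventually_lt continuousAt_const hlt
      obtain ⟨y, ⟨hy1, hy2⟩, hy3⟩ :=
        ((hux.and (nhdsWithin_le_nhds h1)).and self_mem_nhdsWithin).exists
      have h4 := mul_lt_mul_of_pos_left (show u < y from hy3) h.q_pos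
      exact (h.mem_graphDomain.1 (hsub hy1).1).2.2.1
        (h.mem_switchRegion.2 ⟨l, hl1, hl2, by linarith, hy2.le⟩)
    · exact .single (h.step_leftmost hz₀ hg hx hux hl2 heq)
  · have huA : ∃ i < N, u = a i ∨ u = c + 1 - a i := by
      by_contra hne
      push Not at hne
      exact huD (h.mem_graphDomain.2 ⟨by linarith, by linarith, huS, hne⟩)
    obtain ⟨i, hi, rfl | rfl⟩ := huA
    · have hi1 : i + 1 < N := by
        by_contra hcon
        have hi' : i + 1 = N := by omega
        exact huS (h.mem_switchRegion.2 ⟨β i, h.digit_last_pos hi', h.digit_le _,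
          (h.mul_a_last hi').ge, by linarith [h.mul_a_last hi']⟩)
      exact h.reach_leftmost_of_a hz₀ hg (N - (i + 2)) (by omega) hx hux
    · exact h.reach_leftmost_of_b hz₀ hg (N - (i + 1)) (by omega) hx hux

/-! ### Vertices that are reached from everywhere -/

/-- The vertex containing `x` can be reached from every vertex of the reduced graph. -/
def Reached (M : ℕ) (q : ℝ) (β : ℕ → ℕ) (N : ℕ) (c x : ℝ) : Prop :=
  ∀ w ∈ innerDomain M q β N c,
    Relation.TransGen (reducedGraph M q β N).Step (comp M q β N w) (comp M q β N x)

theorem Reached.step {x y : ℝ} (hx : Reached M q β N c x)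
    (hs : (reducedGraph M q β N).Step (comp M q β N x) (comp M q β N y)) :
    Reached M q β N c y := fun w hw => (hx w hw).tail hs

theorem Reached.congr {x y : ℝ} (hx : Reached M q β N c x) (hy : y ∈ comp M q β N x) :
    Reached M q β N c y := by
  have e : comp M q β N x = comp M q β N y := connectedComponentIn_eq hy
  intro w hw
  rw [← e]
  exact hx w hw

theorem Reached.symm (h : FiniteOrbit M N q c β a) {x : ℝ} (hxD : x ∈ innerDomain M q β N c)
    (hx : Reached M q β N c x) : Reached M q β N c (c + 1 - x) := by
  intro w hw
  have h1 := (hx _ (h.mem_innerDomain_symm hw)).lift _ fun I J => h.step_symm (I := I) (J := J)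
  rw [Function.onFun, h.image_comp (h.mem_innerDomain_symm hw).1, h.image_comp hxD.1,
    sub_sub_cancel] at h1
  exact h1

theorem exists_reached_b (h : FiniteOrbit M N q c β a) {k : ℕ} (hk : k < N) :
    ∃ x ∈ innerDomain M q β N c, RightGerm M q β N (c + 1 - a k) x ∧ Reached M q β N c x := by
  induction k with
  | zero =>
    obtain ⟨z, hz, hg⟩ := h.exists_rightGerm_b hk
    refine ⟨z, hz, hg, fun w hw => h.reach_leftmost hz ?_ hw⟩
    rwa [h.a_zero, add_sub_cancel_right] at hg
  | succ k ih =>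
    obtain ⟨x, hx, hux, hR⟩ := ih (by omega)
    obtain ⟨y, hy, huy⟩ := h.exists_rightGerm_b hk
    exact ⟨y, hy, huy, hR.step (h.step_of_rightGerm (Nat.sub_le _ _) hx hy hux (h.mul_b k) huy)⟩

/-- If all vertices in `(c, s)` are reached, then so are the vertices in the image of `(c, s)` under
`x ↦ q x - j`. -/
theorem reached_of_preimage (h : FiniteOrbit M N q c β a) {s : ℝ} (hs1 : s < 1)
    (hR : ∀ x ∈ innerDomain M q β N c, x < s → Reached M q β N c x) {j : ℕ} (hj : j ≤ M) {m : ℝ}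
    (hm : m ∈ innerDomain M q β N c) (h1 : q * c < m + j) (h2 : m + j < q * s) :
    Reached M q β N c m := by
  have hq := h.q_pos
  set y := (m + j) / q with hy
  have hqy : q * y = m + j := by rw [hy]; field_simp
  have e : q * y - j = m := by linarith
  have hcy : c < y := lt_of_mul_lt_mul_left (by linarith) hq.le
  have hys : y < s := lt_of_mul_lt_mul_left (by linarith) hq.le
  have hyD : y ∈ innerDomain M q β N c :=
    ⟨h.mem_graphDomain_of_mul_sub hj (by rwa [e]), hcy, by linarith⟩
  refine (hR y hyD hys).step (h.step_iff.2 ⟨y, j, hj, hyD, by rwa [e], rfl, by rw [e]⟩)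

/-- For a two-digit orbit `1 = β₁/q + β₂/q²`, the condition `c < a₂` says that
`M + 1 < β₁ + β₂`. -/
theorem lt_digit_add_digit (h : FiniteOrbit M N q c β a) (hN : N = 2) :
    M + 1 < β 0 + β 1 := by
  have h0 := h.mul_a 0
  have h1 := h.mul_a_last (k := 1) (by omega)
  have h2 := h.c_lt_a 0 (by omega)
  have h3 := h.mul_top
  rw [h.a_zero] at h0
  simp only [zero_add] at h0 h2
  have h4 : (M : ℝ) + 1 < β 0 + β 1 := by nlinarith [h.one_lt]
  exact_mod_cast h4

/-- An orbit point in the same gap as `c`, with digit `j`, moves to the right. Otherwise the orbit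
would decrease from there on, hence stay in that gap with constant digit `j`, and could not end at
the left end of a switch interval. -/
theorem lt_a_succ (h : FiniteOrbit M N q c β a) {j : ℕ} (hj : j < q * c) {i : ℕ} (hi : i + 1 < N)
    (hai : q * a i < j + 1) : a i < a (i + 1) := by
  by_contra hle
  have hq := h.q_pos
  have hdig : ∀ k, k + 1 < N → a k ≤ a i → β k = j := by
    intro k hk hki
    have e := h.mul_a k
    have g1 := h.c_lt_a k hk
    have g2 := h.a_lt k hk
    have hc := h.c_pos
    have h1 : q * a k ≤ q * a i := mul_le_mul_of_nonneg_left hki hq.le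
    have h2 : q * c < q * a k := mul_lt_mul_of_pos_left (h.a_pos (by omega)) hq
    have h3 : (β k : ℝ) < j + 1 := by linarith
    have h4 : (j : ℝ) < β k + 1 := by linarith
    have h5 : β k < j + 1 := by exact_mod_cast h3
    have h6 : j < β k + 1 := by exact_mod_cast h4
    omega
  have hdec : ∀ n, i + n + 1 < N → a (i + n) ≤ a i ∧ a (i + n + 1) ≤ a (i + n) := by
    intro n
    induction n with
    | zero => exact fun _ => ⟨le_rfl, not_lt.1 hle⟩
    | succ n ih =>
      intro hn
      obtain ⟨h1, h2⟩ := ih (by omega)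
      refine ⟨h2.trans h1, ?_⟩
      have e1 := h.a_succ (i + n)
      have e2 := h.a_succ (i + n + 1)
      rw [hdig (i + n) (by omega) h1] at e1
      rw [hdig (i + n + 1) (by omega) (h2.trans h1)] at e2
      have h3 := mul_le_mul_of_nonneg_left h2 hq.le
      change a (i + n + 1 + 1) ≤ a (i + n + 1)
      linarith
  obtain ⟨n, hn⟩ : ∃ n, i + n + 2 = N := ⟨N - (i + 2), by omega⟩
  obtain ⟨h1, h2⟩ := hdec n (by omega)
  have e := h.mul_a_last (k := i + n + 1) (by omega)
  have h3 : q * a (i + n + 1) ≤ q * a i := mul_le_mul_of_nonneg_left (h2.trans h1) hq.le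
  have h4 : q * c < q * a (i + n + 1) := mul_lt_mul_of_pos_left (h.c_lt_a _ (by omega)) hq
  have h5 : (β (i + n + 1) : ℝ) < j + 1 := by linarith
  have h6 : (j : ℝ) < β (i + n + 1) := by linarith
  have h7 : β (i + n + 1) < j + 1 := by exact_mod_cast h5
  have h8 : j < β (i + n + 1) := by exact_mod_cast h6
  omega

theorem reached_of_mem (h : FiniteOrbit M N q c β a)
    (hyp : ∀ k, k + 2 < N → c + 1 - a 1 < a (k + 1)) {x₀ : ℝ}
    (hx₀ : x₀ ∈ innerDomain M q β N c) : Reached M q β N c x₀ := by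
  by_contra hnx
  have hq := h.q_pos
  have hc := h.c_pos
  set X : Set ℝ := {x | x ∈ innerDomain M q β N c ∧ ¬Reached M q β N c x} with hX
  have hXne : X.Nonempty := ⟨x₀, hx₀, hnx⟩
  have hXb : BddBelow X := ⟨c, fun x hx => hx.1.2.1.le⟩
  -- `s` is the left end of the leftmost vertex that is not reached
  set s := sInf X with hs
  have hcs : c ≤ s := le_csInf hXne fun x hx => hx.1.2.1.le
  have hs1 : s < 1 := (csInf_le hXb hXne.some_mem).trans_lt hXne.some_mem.1.2.2
  have hR : ∀ x ∈ innerDomain M q β N c, x < s → Reached M q β N c x := by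
    intro x hx hxs
    by_contra hcon
    exact not_lt.2 (csInf_le hXb ⟨hx, hcon⟩) hxs
  have hlim : ∀ e, s < e → ∃ x ∈ X, x < e := fun e he => exists_lt_of_csInf_lt hXne he
  have hsD : s ∉ graphDomain M q β N := by
    intro hsD
    have hcs' : c < s := lt_of_le_of_ne hcs fun e => h.c_notMem (e ▸ hsD)
    have hsI : s ∈ innerDomain M q β N c := ⟨hsD, hcs', hs1⟩
    have hnhds : comp M q β N s ∈ 𝓝 s :=
      (isOpen_graphDomain M q β N).connectedComponentIn.mem_nhds (mem_connectedComponentIn hsD)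
    obtain ⟨l, u, ⟨hl, hu⟩, hsub⟩ := mem_nhds_iff_exists_Ioo_subset.1 hnhds
    have hy : (l + s) / 2 ∈ comp M q β N s := hsub ⟨by linarith, by linarith⟩
    obtain ⟨x, hx, hxu⟩ := hlim u hu
    have hxs : s ≤ x := csInf_le hXb hx
    have e : comp M q β N s = comp M q β N ((l + s) / 2) := connectedComponentIn_eq hy
    refine hx.2 ((hR _ (h.comp_subset hsI hy) (by linarith)).congr ?_)
    rw [← e]
    exact hsub ⟨by linarith, hxu⟩
  have hXs : ∀ x ∈ X, s < x := fun x hx =>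
    lt_of_le_of_ne (csInf_le hXb hx) fun e => hsD (e ▸ hx.1.1)
  have hnogerm : ∀ z, RightGerm M q β N s z → ¬Reached M q β N c z := by
    intro z hz hzR
    obtain ⟨e, he, hsub⟩ := mem_nhdsGT_iff_exists_Ioo_subset.1 hz
    obtain ⟨x, hx, hxe⟩ := hlim e he
    exact hx.2 (hzR.congr (hsub ⟨hXs x hx, hxe⟩))
  have hsb : ∀ k < N, s ≠ c + 1 - a k := by
    rintro k hk e
    obtain ⟨z, -, hz, hzR⟩ := h.exists_reached_b hk
    exact hnogerm z (e ▸ hz) hzR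
  have hcs' : c < s := by
    refine lt_of_le_of_ne hcs fun e => hsb 0 h.one_le ?_
    rw [h.a_zero, ← e, add_sub_cancel_right]
  have hqcs : q * c < q * s := mul_lt_mul_of_pos_left hcs' hq
  -- if `(c, s)` contained a whole gap, everything would be reached
  have hgap : ∀ j : ℕ, j ≤ M → q * c ≤ j + c → (j : ℝ) + 1 ≤ q * s → False := by
    intro j hj h1 h2
    exact hnx (h.reached_of_preimage hs1 hR hj hx₀ (by linarith [hx₀.2.1])
      (by linarith [hx₀.2.2]))
  have hmb := h.mul_b 0
  rw [h.a_zero, add_sub_cancel_right, zero_add] at hmb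
  -- if `(c, s)` contains the part of the gap of `c` right of `c`, all of `(b₂, 1)` is reached
  have hcover : M - β 0 + 1 ≤ q * s → ∀ x ∈ X, x ≤ c + 1 - a 1 := by
    intro h1 x hx
    by_contra hlt
    refine hx.2 (h.reached_of_preimage hs1 hR (Nat.sub_le M (β 0)) hx.1 ?_ ?_)
    · linarith
    · rw [Nat.cast_sub (h.digit_le 0)]
      linarith [hx.1.2.2]
  by_cases hsS : s ∈ switchRegion M q
  · obtain ⟨l, hl1, hl2, hl3, hl4⟩ := h.mem_switchRegion.1 hsS
    have hsl : q * s = l + c := by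
      refine le_antisymm hl4 (not_lt.1 fun hlt => ?_)
      obtain ⟨x, hx, hxe⟩ := hlim ((l + c) / q) (by rw [lt_div_iff₀ hq]; linarith)
      rw [lt_div_iff₀ hq] at hxe
      have h1 := mul_lt_mul_of_pos_left (hXs x hx) hq
      exact (h.mem_graphDomain.1 hx.1.1).2.2.1
        (h.mem_switchRegion.2 ⟨l, hl1, hl2, by linarith, by linarith⟩)
    rcases (show 1 = N ∨ 2 ≤ N by have := h.one_le; omega) with hN | hN
    · have e := h.mul_b_last (k := 0) hN
      have hpos := h.digit_last_pos (k := 0) hN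
      rw [h.a_zero, add_sub_cancel_right] at e
      have h1 : ((M + 1 - β 0 : ℕ) : ℝ) < l := by linarith
      have h2 : M + 1 - β 0 + 1 ≤ l := by exact_mod_cast h1
      have h3 : ((M + 1 - β 0 : ℕ) : ℝ) + 1 ≤ l := by exact_mod_cast h2
      exact hgap (M + 1 - β 0) (by omega) e.le (by linarith)
    · have hb1 := h.c_lt_a 0 (by omega)
      have hb2 := h.a_lt 0 (by omega)
      rw [zero_add] at hb1 hb2
      have h1 : ((M - β 0 : ℕ) : ℝ) < l := by linarith
      have h2 : M - β 0 < l := by exact_mod_cast h1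
      rcases (show M - β 0 + 2 ≤ l ∨ l = M - β 0 + 1 by omega) with h3 | h3
      · have h4 : ((M - β 0 : ℕ) : ℝ) + 2 ≤ l := by exact_mod_cast h3
        refine hgap (M - β 0 + 1) (by omega) ?_ ?_
        · push_cast; linarith
        · push_cast; linarith
      · have hl' : (l : ℝ) = M - β 0 + 1 := by
          rw [h3, Nat.cast_add, Nat.cast_sub (h.digit_le 0), Nat.cast_one]
        have hle := hcover (by linarith)
        -- the set of unreached points is symmetric, so it lies in `[a₂, b₂]`
        have hge : ∀ x ∈ X, a 1 ≤ x := by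
          intro x hx
          have hx' : c + 1 - x ∈ X := by
            refine ⟨h.mem_innerDomain_symm hx.1, fun hr => hx.2 ?_⟩
            have := Reached.symm h (h.mem_innerDomain_symm hx.1) hr
            rwa [sub_sub_cancel] at this
          linarith [hle _ hx']
        have has : a 1 ≤ s := le_csInf hXne hge
        have hx₀X : x₀ ∈ X := ⟨hx₀, hnx⟩
        rcases (show N = 2 ∨ 2 < N by omega) with hN2 | hN2
        · have h5 := h.lt_digit_add_digit hN2
          have h6 := h.mul_a_last (k := 1) (by omega)
          have h7 := mul_le_mul_of_nonneg_left has hq.le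
          have h8 : (β 0 : ℝ) + β 1 < M + 2 := by linarith [h.c_lt]
          have h9 : β 0 + β 1 < M + 2 := by exact_mod_cast h8
          omega
        · have h5 := hyp 0 (by omega)
          rw [zero_add] at h5
          linarith [hge _ hx₀X, hle _ hx₀X]
  · have hsA : ∃ i < N, s = a i ∨ s = c + 1 - a i := by
      by_contra hne
      push Not at hne
      exact hsD (h.mem_graphDomain.2 ⟨by linarith, by linarith, hsS, hne⟩)
    obtain ⟨i, hi, hsi⟩ := hsA
    have hsi := hsi.resolve_right (hsb i hi)
    have hi0 : i ≠ 0 := by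
      rintro rfl
      rw [h.a_zero] at hsi
      exact hs1.ne hsi
    have hi1 : i + 1 < N := by
      by_contra hcon
      have hi' : i + 1 = N := by omega
      refine hsS (h.mem_switchRegion.2 ⟨β i, h.digit_last_pos hi', h.digit_le _, ?_, ?_⟩)
      · rw [hsi, h.mul_a_last hi']
      · rw [hsi]; linarith [h.mul_a_last hi']
    have hbs : c + 1 - a 1 < s := by
      obtain ⟨k, rfl⟩ := Nat.exists_eq_succ_of_ne_zero hi0
      rw [hsi]
      exact hyp k (by omega)
    rcases le_or_gt ((M : ℝ) - β 0 + 1) (q * s) with h1 | h1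
    · obtain ⟨x, hx, -⟩ := hlim 1 hs1
      linarith [hXs x hx, hcover h1 x hx]
    · have hb1 := h.c_lt_a 0 (by omega)
      have hb2 := h.a_lt 0 (by omega)
      rw [zero_add] at hb1 hb2
      have hcast : ((M - β 0 : ℕ) : ℝ) = M - β 0 := Nat.cast_sub (h.digit_le 0)
      have hlt : a i < a (i + 1) :=
        h.lt_a_succ (j := M - β 0) (by linarith) hi1 (by rw [← hsi, hcast]; exact h1)
      have hdig : β i = M - β 0 := by
        have e := h.mul_a i
        rw [← hsi] at e
        have g1 := h.c_lt_a i hi1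
        have g2 := h.a_lt i hi1
        have h3 : (β i : ℝ) < (M - β 0 : ℕ) + 1 := by linarith
        have h4 : ((M - β 0 : ℕ) : ℝ) < β i + 1 := by linarith
        have h5 : β i < M - β 0 + 1 := by exact_mod_cast h3
        have h6 : M - β 0 < β i + 1 := by exact_mod_cast h4
        omega
      obtain ⟨x, hx, hxe⟩ := hlim (a (i + 1)) (by rw [hsi]; exact hlt)
      refine hx.2 (h.reached_of_preimage hs1 hR (h.digit_le i) hx.1 ?_ ?_)
      · rw [hdig]; linarith [hXs x hx]
      · rw [hsi, h.mul_a i]; linarith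

theorem stronglyConnected (h : FiniteOrbit M N q c β a)
    (hyp : ∀ k, k + 2 < N → c + 1 - a 1 < a (k + 1)) :
    (reducedGraph M q β N).StronglyConnected := by
  intro I hI J hJ
  obtain ⟨x, hx, rfl⟩ := h.mem_verts_iff.1 hI
  obtain ⟨y, hy, rfl⟩ := h.mem_verts_iff.1 hJ
  exact h.reached_of_mem hyp hy x hx

end FiniteOrbit

/-! ### The greedy orbit as a finite orbit -/

theorem greedyOrbit_eq_zero_of_le {q : ℝ} {N : ℕ} (h : greedyOrbit q N = 0) {n : ℕ} (hn : N ≤ n) :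
    greedyOrbit q n = 0 := by
  induction n, hn using Nat.le_induction with
  | base => exact h
  | succ n _ ih => rw [greedyOrbit, ih, mul_zero, Int.fract_zero]

theorem isLastNonzero_greedyDigit {q : ℝ} (hq : 1 < q) {N : ℕ} (hN : 1 ≤ N)
    (h0 : greedyOrbit q N = 0) (hpos : ∀ k < N, 0 < greedyOrbit q k) :
    IsLastNonzero (greedyDigit q) N := by
  refine ⟨hN, fun hd => ?_, fun n hn => ?_⟩
  · have e := greedyOrbit_succ hq (N - 1)
    rw [hd, Nat.sub_add_cancel hN, h0, Nat.cast_zero, sub_zero] at e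
    exact (mul_pos (by linarith) (hpos (N - 1) (by omega))).ne e
  · rw [greedyDigit, greedyOrbit_eq_zero_of_le h0 hn, mul_zero, Nat.floor_zero]

theorem IsLastNonzero.unique {c : ℕ → ℕ} {m n : ℕ} (hm : IsLastNonzero c m)
    (hn : IsLastNonzero c n) : m = n := by
  have key : ∀ {m n : ℕ}, IsLastNonzero c m → IsLastNonzero c n → m ≤ n := by
    intro m n hm hn
    by_contra hlt
    exact hm.2.1 (hn.2.2 (m - 1) (by omega))
  exact le_antisymm (key hm hn) (key hn hm)

theorem aPt_greedyDigit {M : ℕ} {q : ℝ} (hq : 1 < q) (hqM : q < M + 1) (k : ℕ) :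
    aPt q (greedyDigit q) (k + 1) = greedyOrbit q k := by
  have h := isExpansion_of_orbit (M := M) (c := fun n => greedyDigit q (n + k)) hq
    (fun n => greedyDigit_le hq hqM _) (t := fun n => greedyOrbit q (n + k)) (B := 1)
    (fun n => by rw [← greedyOrbit_succ hq, Nat.add_right_comm])
    (fun n => greedyOrbit_nonneg q _) (fun n => greedyOrbit_le_one q _)
  rw [zero_add] at h
  exact h.2.tsum_eq

theorem finiteOrbit_greedyOrbit {M N : ℕ} {q : ℝ} (hq : 1 < q) (hqM : q < M + 1) (hN : 1 ≤ N)
    (h0 : greedyOrbit q N = 0)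
    (hlow : ∀ k, 1 ≤ k → k < N → (M : ℝ) / (q - 1) - 1 < greedyOrbit q k)
    (hc1 : (M : ℝ) / (q - 1) - 1 < 1) :
    FiniteOrbit M N q (M / (q - 1) - 1) (greedyDigit q) (greedyOrbit q) where
  one_lt := hq
  lt_succ := hqM
  c_lt := hc1
  top_eq := by ring
  aPt_eq := aPt_greedyDigit hq hqM
  one_le := hN
  digit_le := greedyDigit_le hq hqM
  a_zero := rfl
  a_succ := greedyOrbit_succ hq
  a_last := h0
  c_lt_a k hk := hlow (k + 1) (by omega) hk
  a_lt k _ := greedyOrbit_succ_lt q k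

end Univoque

theorem proposition12p5 (M : ℕ) (hM : 1 ≤ M) (q : ℝ)
    (hq : q ∈ closure (Univoque.univoqueBases M) \ Univoque.univoqueBases M) :
    (∃ (β : ℕ → ℕ) (N : ℕ),
      Univoque.IsGreedyExpansion M q 1 β ∧ Univoque.IsLastNonzero β N) ∧
    ∀ (β : ℕ → ℕ) (N : ℕ),
      Univoque.IsGreedyExpansion M q 1 β → Univoque.IsLastNonzero β N →
      (∀ i : ℕ, 1 < i → i < N → Univoque.bPt M q β 2 < Univoque.aPt q β i) →
      (Univoque.reducedGraph M q β N).StronglyConnected := by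
  obtain ⟨h1, hqM, N, hN, h0, hlow⟩ := Univoque.greedyOrbit_of_mem_closure_diff hM hq
  have hc : 0 < (M : ℝ) / (q - 1) - 1 := by
    rw [sub_pos, one_lt_div (by linarith)]; linarith
  have hlast : Univoque.IsLastNonzero (Univoque.greedyDigit q) N := by
    refine Univoque.isLastNonzero_greedyDigit h1 hN h0 fun k hk => ?_
    rcases Nat.eq_zero_or_pos k with rfl | hk0
    · exact zero_lt_one
    · exact hc.trans (hlow k hk0 hk)
  refine ⟨⟨_, N, Univoque.isGreedyExpansion_greedyDigit h1 hqM, hlast⟩, ?_⟩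
  intro β N' hβ hN' hyp
  obtain rfl := hβ.eq_greedyDigit h1 hqM
  obtain rfl := hlast.unique hN'
  have ha := Univoque.aPt_greedyDigit h1 hqM
  rcases lt_or_ge ((M : ℝ) / (q - 1) - 1) 1 with hc1 | hc1
  · refine (Univoque.finiteOrbit_greedyOrbit h1 hqM hN h0 hlow hc1).stronglyConnected
      fun k hk => ?_
    have h2 := hyp (k + 2) (by omega) (by omega)
    rw [Univoque.bPt, ha 1, ha (k + 1)] at h2
    linarith
  · -- here `(b₁, a₁)` is empty, so there are no vertices
    rintro I ⟨⟨x, hx, rfl⟩, hI⟩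
    obtain ⟨h2, h3⟩ := hI (mem_connectedComponentIn hx)
    rw [Univoque.bPt, ha 0, Univoque.greedyOrbit] at h2
    rw [ha 0, Univoque.greedyOrbit] at h3
    linarith
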